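/- Let $n\ge 2$ and let $W\in\mathbb C[z_1,\dots,z_n]$ be a weighted homogeneous polynomial of weight $(w_1,\dots,w_n;h)$ (positive integers with $\gcd(w_1,\dots,w_n,h)=1$) which is non-degenerate: it contains no monomial $z_iz_j$ with $i\neq j$, and the origin is an isolated critical point of $W$. Let $G_W\subset(\mathbb C^*)^n$ be the group of diagonal symmetries of $W$, $N=|G_W|$, let $R_t(z)=(e^{2\pi i w_1t/h}z_1,\dots,e^{2\pi i w_nt/h}z_n)$ be the monodromy (Reeb) flow and $J=R_1\in G_W$. For $\delta>0$ let $L_W=W^{-1}(0)\cap S_\delta^{2n-1}$ be the link. For $g\in G_W$ and $l>0$ let $\Sigma_{g,l}=\{p\in L_W: gR_l(p)=p\}$ be the space of $g$-twisted Reeb orbits $\gamma(t)=R_t(p)$, $g\gamma(l)=\gamma(0)$, of period $l$. The index of such an orbit is taken with respect to the form $\Omega^{\otimes N}$, $\Omega=dz_1\wedge\cdots\wedge dz_n/dW$: choose a $C^1$ unitary frame $F_t$ of $(\ker dW)^{\oplus N}$ along $\gamma$ (for the metric of the symplectic form $\sum_k\frac{1}{\pi w_k}dx_k\wedge dy_k$)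 with $gF_l=F_0$, such that the loop $\Omega^{\otimes N}(F_t)$ in $\mathbb C^*$ has winding number $0$ and the path of symplectic matrices $\psi_t=F_t^{-1}\circ dR_t^{\oplus N}\circ F_0$ has only regular crossings; the index is $\frac1N$ times the Robbin–Salamon index $\frac12\operatorname{sign}\Gamma(\psi,0)+\sum_{0<t<l}\operatorname{sign}\Gamma(\psi,t)+\frac12\operatorname{sign}\Gamma(\psi,l)$, where $\Gamma(\psi,t)$ is the crossing form on $\ker(\psi_t-1)$. When all orbits of $\Sigma_{g,l}$ and all such frames give one and the same value, it is denoted $\mu_{RS}(\Sigma_{g,l})$. A cochain of degree $k$ on $\Sigma_{g,l}/G_W$ is given the degree $k+\star_{g,l}$, where $\star_{g,l}=(n-1)-\mu_{RS}(\Sigma_{g,l})-\frac12(\dim_{\mathbb R}\Sigma_{g,l}+1)$. The monodromy orbit $\Gamma_W$ is the fundamental class $1\in H^0(\Sigma_{J^{-1},1}/G_W;\mathbb Z)$ of the space $\Sigma_{J^{-1},1}=L_W$ of principal orbits, and $\mu_{RS}(\Gamma_W)=\mu_{RS}(\Sigma_{J^{-1},1})$. Then the index $\mu_{RS}(\Gamma_W)$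 is well defined (index values exist and all agree), and $$\deg(\Gamma_W)=-\mu_{RS}(\Gamma_W)=-\frac{2\big((\sum_{i=1}^n w_i)-h\big)}{h}.$$ In particular, $(\sum_{i=1}^n w_i)-h\ge 0$ if and only if $\mu_{RS}(\Gamma_W)\ge 0$. -/

import Mathlib

open scoped BigOperators ComplexConjugate Topology

noncomputable section

namespace MonodromyOrbit

/-! ### The Robbin–Salamon index of a path of symplectic maps -/

section RobbinSalamon

variable {ι : Type*} [Fintype ι]

/-- The standard symplectic form `ω₀(u, v) = Im ∑ conj (u_a) v_a = ∑ dx_a ∧ dy_a (u, v)` of the real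
vector space `ℂ^ι`.  It satisfies `ω₀(u, i u) = ‖u‖² ≥ 0`. -/
def stdSymp (ι : Type*) [Fintype ι] : (ι → ℂ) →ₗ[ℝ] (ι → ℂ) →ₗ[ℝ] ℝ :=
  LinearMap.mk₂ ℝ (fun u v => (∑ a, conj (u a) * v a).im)
    (by intro u u' v; simp [add_mul, Finset.sum_add_distrib])
    (by
      intro c u v
      have : ∀ a, conj ((c • u) a) * v a = (c : ℂ) * (conj (u a) * v a) := by
        intro a; simp [mul_assoc]
      simp only [this, ← Finset.mul_sum, Complex.im_ofReal_mul, smul_eq_mul])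
    (by intro u v v'; simp [mul_add, Finset.sum_add_distrib])
    (by
      intro c u v
      have : ∀ a, conj (u a) * (c • v) a = (c : ℂ) * (conj (u a) * v a) := by
        intro a; simp [mul_left_comm]
      simp only [this, ← Finset.mul_sum, Complex.im_ofReal_mul, smul_eq_mul])

/-- `ker (ψ_t - 1)`; the time `t` is a crossing if this space is nonzero. -/
def crossingSpace (ψ : ℝ → ((ι → ℂ) →L[ℝ] (ι → ℂ))) (t : ℝ) : Submodule ℝ (ι → ℂ) :=
  LinearMap.ker ((ψ t : (ι → ℂ) →ₗ[ℝ] (ι → ℂ)) - LinearMap.id)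

/-- The crossing form `v ↦ ω₀(v, ψ'_t v)` on `ker (ψ_t - 1)`.  For `ψ' = J₀ S ψ`, with `S` symmetric,
it is `v ↦ ⟨v, S_t v⟩`. -/
def crossingForm (ψ : ℝ → ((ι → ℂ) →L[ℝ] (ι → ℂ))) (t : ℝ) :
    QuadraticForm ℝ (crossingSpace ψ t) :=
  LinearMap.BilinMap.toQuadraticMap
    (((stdSymp ι).compl₂ (deriv ψ t).toLinearMap).domRestrict₁₂
      (crossingSpace ψ t) (crossingSpace ψ t))

/-- The signature of the crossing form at time `t` (it is `0` if `t` is not a crossing). -/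
def crossingSign (ψ : ℝ → ((ι → ℂ) →L[ℝ] (ι → ℂ))) (t : ℝ) : ℤ :=
  (sigPos (crossingForm ψ t) : ℤ) - (sigNeg (crossingForm ψ t) : ℤ)

/-- All crossings of the path `ψ` in `[0, l]` are regular: the crossing forms are nondegenerate. -/
def RegularCrossings (ψ : ℝ → ((ι → ℂ) →L[ℝ] (ι → ℂ))) (l : ℝ) : Prop :=
  ∀ t ∈ Set.Icc 0 l, (QuadraticMap.polarBilin (crossingForm ψ t)).SeparatingLeft

/-- The Robbin–Salamon index of a `C¹` path `ψ : [0, l] → Sp(ℂ^ι, ω₀)` with regular crossings: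
`½ sign Γ(ψ, 0) + ∑_{0 < t < l} sign Γ(ψ, t) + ½ sign Γ(ψ, l)`. -/
def robbinSalamon (ψ : ℝ → ((ι → ℂ) →L[ℝ] (ι → ℂ))) (l : ℝ) : ℝ :=
  (crossingSign ψ 0 : ℝ) / 2 + (∑ᶠ t ∈ Set.Ioo 0 l, (crossingSign ψ t : ℝ)) +
    (crossingSign ψ l : ℝ) / 2

end RobbinSalamon

/-! ### Weighted homogeneous polynomials and diagonal symmetries

The number of variables is written `m + 1`, so that `m` is the complex dimension of the Milnor fiber. -/

variable {m : ℕ}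

/-- `W` is a non-degenerate weighted homogeneous polynomial of weight `(w; h)`. -/
structure IsNondegenerate (W : MvPolynomial (Fin (m + 1)) ℂ) (w : Fin (m + 1) → ℕ) (h : ℕ) :
    Prop where
  w_pos : ∀ i, 0 < w i
  h_pos : 0 < h
  gcd_eq_one : Nat.gcd (Finset.univ.gcd w) h = 1
  homogeneous : MvPolynomial.IsWeightedHomogeneous w W h
  /-- `W` contains no monomial `x_i x_j` with `i ≠ j`. -/
  no_mixed_quadratic : ∀ i j, i ≠ j →
    MvPolynomial.coeff (Finsupp.single i 1 + Finsupp.single j 1) W = 0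
  /-- The origin is a critical point of `W`. -/
  critical : ∀ i, MvPolynomial.eval 0 (MvPolynomial.pderiv i W) = 0
  /-- The origin is isolated among the critical points of `W`. -/
  isolated : ∀ᶠ z in 𝓝[≠] (0 : Fin (m + 1) → ℂ),
    ∃ i, MvPolynomial.eval z (MvPolynomial.pderiv i W) ≠ 0

/-- The maximal diagonal symmetry group `G_W`. The action `g • x` is the coordinatewise one. -/
def diagonalSymmetry (W : MvPolynomial (Fin (m + 1)) ℂ) : Subgroup (Fin (m + 1) → ℂˣ) where
  carrier := {g | ∀ x : Fin (m + 1) → ℂ, MvPolynomial.eval (g • x) W = MvPolynomial.eval x W}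
  one_mem' := by intro x; simp
  mul_mem' := by
    intro a b ha hb x
    rw [mul_smul, ha, hb]
  inv_mem' := by
    intro a ha x
    rw [← ha (a⁻¹ • x), smul_inv_smul]

/-- The monodromy (Reeb) flow at time `t`, as an element of the torus:
`(exp (2πi w_1 t / h), …)`.  It acts linearly on `ℂ^{m+1}`, so it is its own linearization. -/
def flow (w : Fin (m + 1) → ℕ) (h : ℕ) (t : ℝ) : Fin (m + 1) → ℂˣ :=
  fun i => Units.mk0 (Complex.exp (2 * Real.pi * Complex.I * ((w i : ℂ) / (h : ℂ)) * (t : ℂ)))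
    (Complex.exp_ne_zero _)

theorem flow_one_mem {W : MvPolynomial (Fin (m + 1)) ℂ} {w : Fin (m + 1) → ℕ} {h : ℕ}
    (hW : IsNondegenerate W w h) : flow w h 1 ∈ diagonalSymmetry W := by
  intro x
  rw [MvPolynomial.eval_eq', MvPolynomial.eval_eq']
  refine Finset.sum_congr rfl fun d hd => ?_
  have hwd := hW.homogeneous (MvPolynomial.mem_support_iff.mp hd)
  have hh : (h : ℂ) ≠ 0 := by exact_mod_cast hW.h_pos.ne'
  have hsum : ∑ i, (d i : ℂ) * (w i : ℂ) = h := by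
    rw [Finsupp.weight_apply, Finsupp.sum_fintype _ _ (by simp)] at hwd
    exact_mod_cast hwd
  have h1 : ∏ i, ((flow w h 1 i : ℂˣ) : ℂ) ^ d i = 1 := by
    have : ∀ i, ((flow w h 1 i : ℂˣ) : ℂ) ^ d i
        = Complex.exp ((2 * Real.pi * Complex.I / h) * ((d i : ℂ) * (w i : ℂ))) := by
      intro i
      simp only [flow, Units.val_mk0, ← Complex.exp_nat_mul]
      congr 1
      push_cast
      field_simp
    simp only [this]
    rw [← Complex.exp_sum, ← Finset.mul_sum, hsum, div_mul_cancel₀ _ hh, Complex.exp_two_pi_mul_I]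
  have h2 : ∏ i, (flow w h 1 • x) i ^ d i = ∏ i, x i ^ d i := by
    have : ∀ i, (flow w h 1 • x) i ^ d i = ((flow w h 1 i : ℂˣ) : ℂ) ^ d i * x i ^ d i := by
      intro i
      rw [← mul_pow]
      rfl
    simp only [this, Finset.prod_mul_distrib, h1, one_mul]
  rw [h2]

/-- The monodromy element `J ∈ G_W`, the time-one map of the flow. -/
def monodromyElement {W : MvPolynomial (Fin (m + 1)) ℂ} {w : Fin (m + 1) → ℕ} {h : ℕ}
    (hW : IsNondegenerate W w h) : diagonalSymmetry W :=
  ⟨flow w h 1, flow_one_mem hW⟩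

/-! ### The link and the components of twisted Reeb orbits -/

/-- The differential `dW_z (v)`. -/
def dW (W : MvPolynomial (Fin (m + 1)) ℂ) (z v : Fin (m + 1) → ℂ) : ℂ :=
  ∑ i, MvPolynomial.eval z (MvPolynomial.pderiv i W) * v i

/-- The link `W⁻¹(0) ∩ S_δ^{2m+1}`. -/
def link (W : MvPolynomial (Fin (m + 1)) ℂ) (δ : ℝ) : Set (Fin (m + 1) → ℂ) :=
  {z | MvPolynomial.eval z W = 0 ∧ ∑ i, ‖z i‖ ^ 2 = δ ^ 2}

/-- The space `Σ_{g,l}` of `g`-twisted Reeb orbits `γ(t) = R_t p`, `0 ≤ t ≤ l`, `g γ(l) = γ(0)`,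
in the link; an orbit is identified with its initial point `p`. -/
def twistedOrbits (W : MvPolynomial (Fin (m + 1)) ℂ) (w : Fin (m + 1) → ℕ) (h : ℕ) (δ : ℝ)
    (g : diagonalSymmetry W) (l : ℝ) : Set (Fin (m + 1) → ℂ) :=
  {p | p ∈ link W δ ∧ (g : Fin (m + 1) → ℂˣ) • (flow w h l • p) = p}

/-- The tangent space at `p` of `Σ_{g,l} = Fix(g R_l) ∩ W⁻¹(0) ∩ S_δ`, a transverse intersection
of the linear space `Fix(g R_l)` with the sphere and with the regular part of `W⁻¹(0)`. -/
def tangentSpace (W : MvPolynomial (Fin (m + 1)) ℂ) (w : Fin (m + 1) → ℕ) (h : ℕ)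
    (g : diagonalSymmetry W) (l : ℝ) (p : Fin (m + 1) → ℂ) : Submodule ℝ (Fin (m + 1) → ℂ) where
  carrier := {v | (g : Fin (m + 1) → ℂˣ) • (flow w h l • v) = v ∧ dW W p v = 0 ∧
    (∑ i, conj (p i) * v i).re = 0}
  zero_mem' := by simp [dW]
  add_mem' := by
    rintro u v ⟨hu, hu', hu''⟩ ⟨hv, hv', hv''⟩
    refine ⟨by rw [smul_add, smul_add, hu, hv], ?_, ?_⟩
    · simp only [dW, Pi.add_apply, mul_add, Finset.sum_add_distrib] at *
      rw [hu', hv', add_zero]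
    · simp only [Pi.add_apply, mul_add, Finset.sum_add_distrib, Complex.add_re] at *
      rw [hu'', hv'', add_zero]
  smul_mem' := by
    rintro c v ⟨hv, hv', hv''⟩
    refine ⟨?_, ?_, ?_⟩
    · conv_rhs => rw [← hv]
      ext i
      simp [Units.smul_def, mul_left_comm]
    · have : ∀ i, MvPolynomial.eval p (MvPolynomial.pderiv i W) * (c • v) i
          = (c : ℂ) * (MvPolynomial.eval p (MvPolynomial.pderiv i W) * v i) := by
        intro i; simp [mul_left_comm]
      simp only [dW, this, ← Finset.mul_sum] at *
      rw [hv', mul_zero]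
    · have : ∀ i, conj (p i) * (c • v) i = (c : ℂ) * (conj (p i) * v i) := by
        intro i; simp [mul_left_comm]
      simp only [this, ← Finset.mul_sum, Complex.re_ofReal_mul] at *
      rw [hv'', mul_zero]

/-- The real dimension of `Σ_{g,l}`. -/
def orbitsDim (W : MvPolynomial (Fin (m + 1)) ℂ) (w : Fin (m + 1) → ℕ) (h : ℕ) (δ : ℝ)
    (g : diagonalSymmetry W) (l : ℝ) : ℕ :=
  sSup {d | ∃ p ∈ twistedOrbits W w h δ g l, d = Module.finrank ℝ (tangentSpace W w h g l p)}

/-! ### Fractional Robbin–Salamon indices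

The linearized Reeb flow acts on `T = ker dW` along an orbit.  Write `N = |G_W|`.  The form `Ω^{⊗N}`,
where `Ω = dz_1 ∧ … ∧ dz_{m+1} / dW`, descends to the quotient by `G_W`; it is a nowhere zero section
of the dual of the top exterior power of `T^{⊕N}`.  The index of an orbit with respect to `Ω^{⊗N}` is
the index of the `N`-fold direct sum of the linearized flow in a unitary frame of `T^{⊕N}` along
the orbifold loop on which `Ω^{⊗N}` is homotopic to a constant. -/

/-- The Hermitian metric on `(ℂ^{m+1})^{⊕N}` belonging to the symplectic form
`∑_k (π w_k)⁻¹ dx_k ∧ dy_k = d(∑_k (i / 4π w_k) (z_k dz̄_k - z̄_k dz_k))`. -/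
def herm (w : Fin (m + 1) → ℕ) {N : ℕ} (u v : Fin N → Fin (m + 1) → ℂ) : ℂ :=
  ∑ c, ∑ k, ((Real.pi * (w k : ℝ))⁻¹ : ℝ) * (conj (u c k) * v c k)

/-- A vector with `dW_z = 1` (at a regular point `z`): the normalized Hermitian gradient. -/
def normalVector (W : MvPolynomial (Fin (m + 1)) ℂ) (z : Fin (m + 1) → ℂ) : Fin (m + 1) → ℂ :=
  fun i => conj (MvPolynomial.eval z (MvPolynomial.pderiv i W)) /
    ((∑ k, ‖MvPolynomial.eval z (MvPolynomial.pderiv k W)‖ ^ 2 : ℝ) : ℂ)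

/-- `Ω^{⊗N}` evaluated on a frame `F` of `T^{⊕N}` at `z`.  Here
`Ω(v_1, …, v_m) = det (ν, v_1, …, v_m)` for any `ν` with `dW_z(ν) = 1`; for `T^{⊕N}` one completes
the frame by one such vector in each of the `N` copies. -/
def volumeForm (W : MvPolynomial (Fin (m + 1)) ℂ) {N : ℕ} (z : Fin (m + 1) → ℂ)
    (F : Fin N × Fin m → Fin N → Fin (m + 1) → ℂ) : ℂ :=
  Matrix.det (Matrix.of fun (r s : Fin N × Fin (m + 1)) =>
    (Fin.cases (if r.1 = s.1 then normalVector W z r.2 else 0)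
      (fun j => F (s.1, j) r.1 r.2) s.2 : ℂ))

/-- `F` is a unitary frame of `T^{⊕N}`, `N = |G_W|`, along the `g`-twisted orbit of period `l`
through `p`, compatible with the twist and adapted to `Ω^{⊗N}`. -/
structure IsAdaptedFrame (W : MvPolynomial (Fin (m + 1)) ℂ) (w : Fin (m + 1) → ℕ) (h : ℕ)
    (g : diagonalSymmetry W) (l : ℝ) (p : Fin (m + 1) → ℂ)
    (F : ℝ → Fin (Nat.card (diagonalSymmetry W)) × Fin m →
      Fin (Nat.card (diagonalSymmetry W)) → Fin (m + 1) → ℂ) : Prop where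
  contDiff : ContDiff ℝ 1 F
  tangent : ∀ t ∈ Set.Icc 0 l, ∀ a c, dW W (flow w h t • p) (F t a c) = 0
  orthonormal : ∀ t ∈ Set.Icc 0 l, ∀ a b, herm w (F t a) (F t b) = if a = b then 1 else 0
  twist : ∀ a c, (g : Fin (m + 1) → ℂˣ) • F l a c = F 0 a c
  /-- The loop `t ↦ Ω^{⊗N}(F_t)` in `ℂ \ {0}` has winding number zero. -/
  adapted : ∃ L : ℝ → ℂ, ContinuousOn L (Set.Icc 0 l) ∧
    (∀ t ∈ Set.Icc 0 l, Complex.exp (L t) = volumeForm W (flow w h t • p) (F t)) ∧ L l = L 0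

/-- The `N`-fold direct sum of the linearized Reeb flow `T_p → T_{R_t p}` in the unitary frame `F`,
that is `F_t⁻¹ ∘ dR_t ∘ F_0`. -/
def flowMatrix (w : Fin (m + 1) → ℕ) (h : ℕ) {N : ℕ}
    (F : ℝ → Fin N × Fin m → Fin N → Fin (m + 1) → ℂ) (t : ℝ) :
    Matrix (Fin N × Fin m) (Fin N × Fin m) ℂ :=
  Matrix.of fun a b => herm w (F t a) (fun c => flow w h t • F 0 b c)

/-- The same path, in the group of real linear symplectic maps. -/
def flowPath (w : Fin (m + 1) → ℕ) (h : ℕ) {N : ℕ}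
    (F : ℝ → Fin N × Fin m → Fin N → Fin (m + 1) → ℂ) (t : ℝ) :
    (Fin N × Fin m → ℂ) →L[ℝ] (Fin N × Fin m → ℂ) :=
  LinearMap.toContinuousLinearMap ((flowMatrix w h F t).mulVecLin.restrictScalars ℝ)

/-- The values `(1/N) μ_RS^{Ω^{⊗N}}` of the index over all orbits of `Σ_{g,l}` and over all adapted
frames in which the linearized flow has regular crossings. -/
def indexValues (W : MvPolynomial (Fin (m + 1)) ℂ) (w : Fin (m + 1) → ℕ) (h : ℕ) (δ : ℝ)
    (g : diagonalSymmetry W) (l : ℝ) : Set ℝ :=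
  {μ | ∃ p ∈ twistedOrbits W w h δ g l, ∃ F, IsAdaptedFrame W w h g l p F ∧
    RegularCrossings (flowPath w h F) l ∧
    μ = robbinSalamon (flowPath w h F) l / (Nat.card (diagonalSymmetry W) : ℝ)}

/-- The Robbin–Salamon index `μ_RS(Σ_{g,l})`: the unique index value. -/
def componentIndex (W : MvPolynomial (Fin (m + 1)) ℂ) (w : Fin (m + 1) → ℕ) (h : ℕ) (δ : ℝ)
    (g : diagonalSymmetry W) (l : ℝ) : ℝ :=
  Classical.epsilon fun μ : ℝ => indexValues W w h δ g l = {μ}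

/-- The degree shifting number
`⋆_{g,l} = (n - 1) - μ_RS(Σ_{g,l}) - (dim_ℝ Σ_{g,l} + 1) / 2`, where `n - 1 = m`. -/
def degreeShift (W : MvPolynomial (Fin (m + 1)) ℂ) (w : Fin (m + 1) → ℕ) (h : ℕ) (δ : ℝ)
    (g : diagonalSymmetry W) (l : ℝ) : ℝ :=
  (m : ℝ) - componentIndex W w h δ g l - ((orbitsDim W w h δ g l : ℝ) + 1) / 2

/-! ### Cochains of the Morse–Bott components and the monodromy orbit -/

/-- The orbit space `Σ_{g,l} / G_W`. -/
def OrbitSpace (W : MvPolynomial (Fin (m + 1)) ℂ) (w : Fin (m + 1) → ℕ) (h : ℕ) (δ : ℝ)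
    (g : diagonalSymmetry W) (l : ℝ) : Type :=
  Quotient ((MulAction.orbitRel (diagonalSymmetry W) (Fin (m + 1) → ℂ)).comap
    (Subtype.val : twistedOrbits W w h δ g l → (Fin (m + 1) → ℂ)))

instance (W : MvPolynomial (Fin (m + 1)) ℂ) (w : Fin (m + 1) → ℕ) (h : ℕ) (δ : ℝ)
    (g : diagonalSymmetry W) (l : ℝ) : TopologicalSpace (OrbitSpace W w h δ g l) :=
  inferInstanceAs (TopologicalSpace (Quotient _))

/-- A homogeneous element of `⨁_{g,l} C^{• - ⋆_{g,l}}(Σ_{g,l} / G_W; ℤ)`: a (singular) integral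
cochain on one of the spaces of nonconstant twisted Reeb orbits modulo `G_W`. -/
structure OrbitCochain (W : MvPolynomial (Fin (m + 1)) ℂ) (w : Fin (m + 1) → ℕ) (h : ℕ)
    (δ : ℝ) where
  g : diagonalSymmetry W
  l : ℝ
  l_pos : 0 < l
  k : ℕ
  cochain : C(stdSimplex ℝ (Fin (k + 1)), OrbitSpace W w h δ g l) → ℤ

namespace OrbitCochain

variable {W : MvPolynomial (Fin (m + 1)) ℂ} {w : Fin (m + 1) → ℕ} {h : ℕ} {δ : ℝ}

/-- The degree of a cochain in `C^{• - ⋆_{g,l}}(Σ_{g,l} / G_W)`. -/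
def deg (c : OrbitCochain W w h δ) : ℝ := (c.k : ℝ) + degreeShift W w h δ c.g c.l

/-- The index values of the orbits that carry the cochain. -/
def indexValues (c : OrbitCochain W w h δ) : Set ℝ :=
  MonodromyOrbit.indexValues W w h δ c.g c.l

/-- The Robbin–Salamon index of the orbits that carry the cochain. -/
def muRS (c : OrbitCochain W w h δ) : ℝ := componentIndex W w h δ c.g c.l

end OrbitCochain

/-- The monodromy orbit `Γ_W`: the fundamental class `1 ∈ H^0(Σ_{J⁻¹,1} / G_W; ℤ)` of the space
`Σ_{J⁻¹,1} = L_W` of principal orbits, represented by the `0`-cochain with constant value `1`. -/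
def monodromyOrbit {W : MvPolynomial (Fin (m + 1)) ℂ} {w : Fin (m + 1) → ℕ} {h : ℕ}
    (hW : IsNondegenerate W w h) (δ : ℝ) : OrbitCochain W w h δ where
  g := (monodromyElement hW)⁻¹
  l := 1
  l_pos := one_pos
  k := 0
  cochain := fun _ => 1

end MonodromyOrbit

end

/-! In a unitary frame the linearized flow along a principal orbit is a loop `ψ` of unitary matrices
based at `1`. Adaptedness to `Ω^{⊗N}` makes `det ψ` wind as often as the flow rotates `Ω^{⊗N}`, that
is, `N (∑ wᵢ / h - 1)` times, and the Robbin–Salamon index of a unitary loop is twice the winding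
number of its determinant.

For the latter, `1 - ψ` has positive semidefinite Hermitian part, so that off the crossings
`det (1 - ψ)` has a canonical continuous argument `α`. The identity `1 - ψ = -ψ (1 - ψ)ᴴ` makes
`2 α - arg det ψ` constant modulo `2π`, hence locally constant off the crossings. At a regular
crossing it drops by `π` times the signature of the crossing form, as one sees by dilating the
kernel of `1 - ψ t` by `|s - t|^{-1/2}` as `s → t`; the jumps add up to the index.

Adapted frames with regular crossings exist: twist a unitary frame transported by the flow by
characters `t ↦ exp (-2πi κₐ t)` with nonzero `κₐ` adding up to `N (∑ wᵢ / h - 1)`.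
-/

noncomputable section

namespace MonodromyOrbit

open Filter Set
open scoped Matrix ComplexOrder

/-! ### Continuous logarithms and arguments -/

section Arguments

theorem exists_continuousOn_log {E : Type*} [AddCommGroup E] [Module ℝ E] [TopologicalSpace E]
    [ContinuousAdd E] [ContinuousSMul ℝ E] {s : Set E} {x₀ : E} (hs : StarConvex ℝ x₀ s)
    (hx₀ : x₀ ∈ s) {f : E → ℂ} (hf : ContinuousOn f s) (hf0 : ∀ x ∈ s, f x ≠ 0) {ℓ₀ : ℂ}
    (hℓ₀ : Complex.exp ℓ₀ = f x₀) :
    ∃ L : E → ℂ, ContinuousOn L s ∧ L x₀ = ℓ₀ ∧ ∀ x ∈ s, Complex.exp (L x) = f x := by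
  have segment_mem (p : unitInterval × s) : (1 - (p.1 : ℝ)) • x₀ + (p.1 : ℝ) • (p.2 : E) ∈ s :=
    hs p.2.2 (sub_nonneg.mpr p.1.2.2) p.1.2.1 (sub_add_cancel _ _)
  let H : C(unitInterval × s, {z : ℂ // z ≠ 0}) :=
    ⟨fun p => ⟨f ((1 - (p.1 : ℝ)) • x₀ + (p.1 : ℝ) • (p.2 : E)), hf0 _ (segment_mem p)⟩,
      (hf.comp_continuous (by fun_prop) segment_mem).subtype_mk _⟩
  have H_zero (x : s) : H (0, x) = ⟨Complex.exp ℓ₀, Complex.exp_ne_zero _⟩ := by simp [H, hℓ₀]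
  have cov := Complex.isCoveringMap_exp
  let lift : C(unitInterval × s, ℂ) := cov.liftHomotopy H (.const s ℓ₀) H_zero
  have exp_lift (p : unitInterval × s) : Complex.exp (lift p) = H p :=
    congrArg Subtype.val (congrFun (cov.liftHomotopy_lifts H (.const s ℓ₀) H_zero) p)
  have lift_base : lift (1, ⟨x₀, hx₀⟩) = ℓ₀ := by
    refine (?_ : lift (1, ⟨x₀, hx₀⟩) = lift (0, ⟨x₀, hx₀⟩)).trans
      (cov.liftHomotopy_zero H (.const s ℓ₀) H_zero ⟨x₀, hx₀⟩)
    refine cov.const_of_comp (g := fun t => lift (t, ⟨x₀, hx₀⟩)) (by fun_prop) (fun t t' => ?_) 1 0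
    exact Subtype.ext (by simp [exp_lift, H, ← add_smul])
  have extend_apply (x : s) :
      Function.extend Subtype.val (fun x : s => lift (1, x)) 0 x = lift (1, x) :=
    Subtype.val_injective.extend_apply _ _ _
  refine ⟨Function.extend Subtype.val (fun x : s => lift (1, x)) 0, ?_, ?_, fun x hx => ?_⟩
  · exact continuousOn_iff_continuous_domRestrict.mpr
      ((show Continuous fun x : s => lift (1, x) by fun_prop).congr fun x => (extend_apply x).symm)
  · exact (extend_apply ⟨x₀, hx₀⟩).trans lift_base
  · rw [extend_apply ⟨x, hx⟩, exp_lift]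
    simp [H]

theorem coe_im_of_exp_eq {ℓ z : ℂ} (h : Complex.exp ℓ = z) : (ℓ.im : Real.Angle) = z.arg := by
  rw [← h, Complex.arg_exp, Real.Angle.coe_toIocMod]

theorem sub_eq_sub_of_coe_angle_eq {X : Type*} [TopologicalSpace X] {s : Set X}
    (hs : IsPreconnected s) {φ χ : X → ℝ} (hφ : ContinuousOn φ s) (hχ : ContinuousOn χ s)
    {θ : Real.Angle} (h : ∀ x ∈ s, (φ x : Real.Angle) = χ x + θ) {a b : X} (ha : a ∈ s)
    (hb : b ∈ s) : φ b - φ a = χ b - χ a := by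
  have hconst : φ b - χ b = φ a - χ a :=
    (AddCircle.isCoveringMap_coe (2 * Real.pi)).constOn_of_comp hs (hφ.sub hχ) (fun x hx y hy => by
      change ((φ x - χ x : ℝ) : Real.Angle) = (φ y - χ y : ℝ)
      simp only [Real.Angle.coe_sub, h x hx, h y hy, add_sub_cancel_left]) hb ha
  linarith

theorem eventually_eq_of_coe_angle_eq {α : Type*} {F : Filter α} {f : α → ℝ} {x : ℝ}
    {θ : Real.Angle} (hf : Tendsto f F (𝓝 x)) (h : ∀ᶠ s in F, (f s : Real.Angle) = θ) :
    ∀ᶠ s in F, f s = x := by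
  rcases F.eq_or_neBot with rfl | _
  · exact eventually_bot
  have hx : (x : Real.Angle) = θ :=
    tendsto_nhds_unique ((Real.Angle.continuous_coe.tendsto x).comp hf)
      (tendsto_nhds_of_eventually_eq h)
  obtain ⟨U, hU, hxU, hinj⟩ :=
    (AddCircle.isCoveringMap_coe (2 * Real.pi)).isLocalHomeomorph.isLocallyInjective x
  filter_upwards [h, hf (hU.mem_nhds hxU)] with s hs hsU
  exact hinj hsU hxU (hs.trans hx.symm)

end Arguments

/-! ### The argument of the determinant of an accretive matrix -/

section Accretive

variable {k : Type*} [Fintype k] [DecidableEq k]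

/-- The invertible complex matrices with positive semidefinite Hermitian part. They form a set which
is star-shaped around `1`, so their determinants have a canonical argument. -/
def accretive (k : Type*) [Fintype k] [DecidableEq k] : Set (Matrix k k ℂ) :=
  {M | (∀ v : k → ℂ, 0 ≤ (star v ⬝ᵥ M *ᵥ v).re) ∧ M.det ≠ 0}

theorem posDef_mem_accretive {M : Matrix k k ℂ} (hM : M.PosDef) : M ∈ accretive k :=
  ⟨fun v => hM.posSemidef.re_dotProduct_nonneg v, hM.det_pos.ne'⟩

theorem starConvex_accretive : StarConvex ℝ (1 : Matrix k k ℂ) (accretive k) := by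
  intro M hM a b ha hb hab
  have quadratic_form (v : k → ℂ) : (star v ⬝ᵥ (a • (1 : Matrix k k ℂ) + b • M) *ᵥ v).re
      = a * (star v ⬝ᵥ v).re + b * (star v ⬝ᵥ M *ᵥ v).re := by
    simp [Matrix.add_mulVec, Matrix.smul_mulVec, dotProduct_add, dotProduct_smul]
  have norm_nonneg (v : k → ℂ) : 0 ≤ (star v ⬝ᵥ v).re :=
    (Complex.le_def.mp (dotProduct_star_self_nonneg v)).1
  refine ⟨fun v => ?_, ?_⟩
  · have := hM.1 v
    have := norm_nonneg v
    rw [quadratic_form]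
    positivity
  · rcases ha.eq_or_lt with rfl | ha
    · simpa [show b = 1 by linarith] using hM.2
    · intro hdet
      obtain ⟨v, hv, hMv⟩ := Matrix.exists_mulVec_eq_zero_iff.mpr hdet
      have form_eq := quadratic_form v
      rw [hMv, dotProduct_zero, Complex.zero_re] at form_eq
      have hv_pos : 0 < (star v ⬝ᵥ v).re :=
        (Complex.lt_def.mp (Matrix.dotProduct_star_self_pos_iff.mpr hv)).1
      have := mul_nonneg hb (hM.1 v)
      have := mul_pos ha hv_pos
      linarith

theorem exists_continuousOn_log_det : ∃ L : Matrix k k ℂ → ℂ, ContinuousOn L (accretive k) ∧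
    L 1 = 0 ∧ ∀ M ∈ accretive k, Complex.exp (L M) = M.det :=
  exists_continuousOn_log starConvex_accretive (posDef_mem_accretive Matrix.PosDef.one)
    (continuous_id.matrix_det).continuousOn (fun _ hM => hM.2) (by simp)

/-- The argument of the determinant of an accretive matrix, continuous and zero at `1`. -/
def argDet (M : Matrix k k ℂ) : ℝ := (exists_continuousOn_log_det.choose M).im

theorem continuousOn_argDet : ContinuousOn argDet (accretive k) :=
  Complex.continuous_im.comp_continuousOn exists_continuousOn_log_det.choose_spec.1

theorem argDet_one : argDet (1 : Matrix k k ℂ) = 0 := by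
  rw [argDet, exists_continuousOn_log_det.choose_spec.2.1, Complex.zero_im]

theorem coe_argDet {M : Matrix k k ℂ} (hM : M ∈ accretive k) :
    (argDet M : Real.Angle) = M.det.arg :=
  coe_im_of_exp_eq (exists_continuousOn_log_det.choose_spec.2.2 M hM)

theorem argDet_sub_argDet {X : Type*} [TopologicalSpace X] {s : Set X} (hs : IsPreconnected s)
    {γ : X → Matrix k k ℂ} (hγ : ContinuousOn γ s) (hmem : ∀ x ∈ s, γ x ∈ accretive k)
    {φ : X → ℝ} (hφ : ContinuousOn φ s) {θ : Real.Angle}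
    (harg : ∀ x ∈ s, ((γ x).det.arg : Real.Angle) = φ x + θ) {a b : X} (ha : a ∈ s) (hb : b ∈ s) :
    argDet (γ b) - argDet (γ a) = φ b - φ a :=
  sub_eq_sub_of_coe_angle_eq hs (continuousOn_argDet.comp hγ hmem) hφ
    (fun x hx => (coe_argDet (hmem x hx)).trans (harg x hx)) ha hb

omit [Fintype k] [DecidableEq k] in
theorem convex_setOf_posDef : Convex ℝ {M : Matrix k k ℂ | M.PosDef} :=
  convex_iff_forall_pos.mpr fun _ hA _ hB _ _ ha hb _ => (hA.smul ha).add (hB.smul hb)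

theorem mul_mul_mem_accretive {D M : Matrix k k ℂ} (hD : D.PosDef) (hM : M ∈ accretive k) :
    D * M * D ∈ accretive k := by
  refine ⟨fun v => ?_, by simp [Matrix.det_mul, hM.2, hD.det_pos.ne']⟩
  have h := hM.1 (D *ᵥ v)
  rwa [Matrix.star_mulVec, hD.isHermitian.eq, ← Matrix.dotProduct_mulVec, Matrix.mulVec_mulVec,
    Matrix.mulVec_mulVec] at h

theorem argDet_mul_mul {D M : Matrix k k ℂ} (hD : D.PosDef) (hM : M ∈ accretive k) :
    argDet (D * M * D) = argDet M := by
  have h := argDet_sub_argDet (convex_setOf_posDef (k := k)).isPreconnected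
    (γ := fun D => D * M * D) (by fun_prop) (fun D hD => mul_mul_mem_accretive hD hM)
    (φ := fun _ => 0) continuousOn_const (θ := M.det.arg) (fun D hD => ?_) Matrix.PosDef.one hD
  · simpa [sub_eq_zero] using h
  · have hdet := hD.det_pos
    rw [Complex.lt_def] at hdet
    have hD_real : D.det = (D.det.re : ℂ) := Complex.ext rfl (by simpa using hdet.2.symm)
    rw [Matrix.det_mul, Matrix.det_mul, mul_right_comm, hD_real, ← Complex.ofReal_mul,
      Complex.arg_real_mul _ (mul_pos hdet.1 hdet.1)]
    simp

theorem argDet_eq_zero_of_posDef {M : Matrix k k ℂ} (hM : M.PosDef) : argDet M = 0 := by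
  have h := argDet_sub_argDet (convex_setOf_posDef (k := k)).isPreconnected continuousOn_id
    (fun _ => posDef_mem_accretive) (φ := fun _ => 0) continuousOn_const (θ := 0)
    (fun D hD => ?_) Matrix.PosDef.one hM
  · simpa [argDet_one] using h
  · simp [Complex.arg_eq_zero_iff_zero_le.mpr hD.det_pos.le]

end Accretive

/-! ### Functions of a Hermitian matrix -/

section FunctionalCalculus

variable {k : Type*} [Fintype k] [DecidableEq k] {G : Matrix k k ℂ}

/-- The functional calculus `f ↦ f(G)` of a Hermitian matrix `G`, for complex valued functions of
the (real) eigenvalues. -/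
def hermitianFun (hG : G.IsHermitian) : (ℝ → ℂ) →⋆ₐ[ℂ] Matrix k k ℂ where
  toFun f := Unitary.conjStarAlgAut ℂ _ hG.eigenvectorUnitary
    (Matrix.diagonal fun j => f (hG.eigenvalues j))
  map_one' := (congrArg _ Matrix.diagonal_one).trans (map_one _)
  map_mul' f g := by rw [← map_mul, Matrix.diagonal_mul_diagonal]; rfl
  map_zero' := (congrArg _ Matrix.diagonal_zero).trans (map_zero _)
  map_add' f g := by rw [← map_add, Matrix.diagonal_add]; rfl
  commutes' c := by
    rw [← AlgEquivClass.commutes (Unitary.conjStarAlgAut ℂ (Matrix k k ℂ) hG.eigenvectorUnitary) c]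
    rfl
  map_star' f := by
    rw [← map_star, Matrix.star_eq_conjTranspose, Matrix.diagonal_conjTranspose]
    rfl

theorem hermitianFun_apply (hG : G.IsHermitian) (f : ℝ → ℂ) :
    hermitianFun hG f = (hG.eigenvectorUnitary : Matrix k k ℂ) *
      Matrix.diagonal (fun j => f (hG.eigenvalues j)) *
        (hG.eigenvectorUnitary : Matrix k k ℂ)ᴴ :=
  Unitary.conjStarAlgAut_apply (S := ℂ) hG.eigenvectorUnitary
    (Matrix.diagonal fun j => f (hG.eigenvalues j))

theorem hermitianFun_ofReal (hG : G.IsHermitian) : hermitianFun hG (fun x => (x : ℂ)) = G :=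
  hG.spectral_theorem.symm

theorem det_hermitianFun (hG : G.IsHermitian) (f : ℝ → ℂ) :
    (hermitianFun hG f).det = ∏ j, f (hG.eigenvalues j) := by
  rw [hermitianFun_apply, Matrix.det_mul_right_comm, ← Matrix.star_eq_conjTranspose,
    Unitary.mul_star_self_of_mem hG.eigenvectorUnitary.2, one_mul, Matrix.det_diagonal]

theorem hermitianFun_mul_eq_zero (hG : G.IsHermitian) {f : ℝ → ℂ} (hf : f 0 = 0)
    {Z : Matrix k k ℂ} (hGZ : G * Z = 0) : hermitianFun hG f * Z = 0 := by
  have hfactor : f = (fun x : ℝ => f x / x) * fun x : ℝ => (x : ℂ) := by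
    ext x
    rcases eq_or_ne x 0 with rfl | hx <;> simp [*]
  rw [hfactor, map_mul, hermitianFun_ofReal, mul_assoc, hGZ, mul_zero]

theorem mul_hermitianFun_eq_zero (hG : G.IsHermitian) {f : ℝ → ℂ} (hf : f 0 = 0)
    {Z : Matrix k k ℂ} (hZG : Z * G = 0) : Z * hermitianFun hG f = 0 := by
  have h := hermitianFun_mul_eq_zero hG (f := star f) (by simp [hf]) (Z := Zᴴ)
    (by rw [← hG.eq, ← Matrix.conjTranspose_mul, hZG, Matrix.conjTranspose_zero])
  rwa [map_star, Matrix.star_eq_conjTranspose, ← Matrix.conjTranspose_mul,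
    Matrix.conjTranspose_eq_zero] at h

theorem dotProduct_hermitianFun_mulVec (hG : G.IsHermitian) (f : ℝ → ℂ) (v : k → ℂ) :
    star v ⬝ᵥ hermitianFun hG f *ᵥ v = ∑ j, f (hG.eigenvalues j) *
      (‖((hG.eigenvectorUnitary : Matrix k k ℂ)ᴴ *ᵥ v) j‖ ^ 2 : ℝ) := by
  rw [hermitianFun_apply, ← Matrix.mulVec_mulVec, ← Matrix.mulVec_mulVec, Matrix.dotProduct_mulVec,
    ← Matrix.conjTranspose_conjTranspose (hG.eigenvectorUnitary : Matrix k k ℂ),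
    ← Matrix.star_mulVec, Matrix.conjTranspose_conjTranspose]
  refine Finset.sum_congr rfl fun j _ => ?_
  rw [Matrix.mulVec_diagonal, Pi.star_apply, mul_left_comm, Complex.star_def, Complex.conj_mul',
    Complex.ofReal_pow]

theorem re_dotProduct_hermitianFun_nonneg (hG : G.IsHermitian) {f : ℝ → ℂ}
    (hf : ∀ x, 0 ≤ (f x).re) (v : k → ℂ) : 0 ≤ (star v ⬝ᵥ hermitianFun hG f *ᵥ v).re := by
  rw [dotProduct_hermitianFun_mulVec, Complex.re_sum]
  refine Finset.sum_nonneg fun j _ => ?_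
  rw [Complex.re_mul_ofReal]
  exact mul_nonneg (hf _) (sq_nonneg _)

/-- The number of positive minus the number of negative eigenvalues. -/
def signature (hG : G.IsHermitian) : ℤ := ∑ j, SignType.sign (hG.eigenvalues j)

end FunctionalCalculus

/-! ### Rotating the Hermitian part of an accretive matrix -/

section Rotation

variable {k : Type*} [Fintype k] [DecidableEq k] {Z G : Matrix k k ℂ}

/-- The sum of `Z` and `|G| exp (iθ sign G)`. Between `θ = -π/2` and `θ = π/2` this interpolates
from `Z - iG` to `Z + iG`, and only the argument of the determinant changes. -/
def rotated (Z : Matrix k k ℂ) (hG : G.IsHermitian) (θ : ℝ) : Matrix k k ℂ :=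
  Z + hermitianFun hG fun x => |x| * Complex.exp (SignType.sign x * θ * Complex.I)

theorem abs_mul_exp_sign (x θ : ℝ) :
    |x| * Complex.exp (SignType.sign x * θ * Complex.I)
      = Real.cos θ * |x| + Real.sin θ * Complex.I * x := by
  rcases lt_trichotomy x 0 with hx | rfl | hx
  · simp only [hx, abs_of_neg, sign_neg, SignType.coe_neg_one, neg_one_mul, Complex.exp_mul_I,
      Complex.cos_neg, Complex.sin_neg, Complex.ofReal_neg, Complex.ofReal_cos, Complex.ofReal_sin]
    ring
  · simp
  · simp only [hx, abs_of_pos, sign_pos, SignType.coe_one, one_mul, Complex.exp_mul_I,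
      Complex.ofReal_cos, Complex.ofReal_sin]
    ring

theorem rotated_eq_add_add (Z : Matrix k k ℂ) (hG : G.IsHermitian) (θ : ℝ) :
    rotated Z hG θ = Z + (Real.cos θ : ℂ) • hermitianFun hG (fun x => (|x| : ℝ)) +
      (Real.sin θ * Complex.I) • G := by
  have hpolar : (fun x : ℝ => |x| * Complex.exp (SignType.sign x * θ * Complex.I))
      = (Real.cos θ : ℂ) • (fun x : ℝ => ((|x| : ℝ) : ℂ))
        + (Real.sin θ * Complex.I) • fun x : ℝ => (x : ℂ) :=
    funext fun x => abs_mul_exp_sign x θ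
  rw [rotated, hpolar, map_add, map_smul, map_smul, hermitianFun_ofReal, add_assoc]

theorem continuous_rotated (Z : Matrix k k ℂ) (hG : G.IsHermitian) : Continuous (rotated Z hG) := by
  simp only [funext (rotated_eq_add_add Z hG)]
  fun_prop

theorem rotated_pi_div_two (Z : Matrix k k ℂ) (hG : G.IsHermitian) :
    rotated Z hG (Real.pi / 2) = Z + Complex.I • G := by
  simp [rotated_eq_add_add]

theorem rotated_neg_pi_div_two (Z : Matrix k k ℂ) (hG : G.IsHermitian) :
    rotated Z hG (-(Real.pi / 2)) = Z - Complex.I • G := by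
  simp [rotated_eq_add_add, sub_eq_add_neg]

theorem det_rotated (hG : G.IsHermitian) (hZG : Z * G = 0) (θ : ℝ) :
    (rotated Z hG θ).det =
      (rotated Z hG 0).det * Complex.exp ((signature hG * θ : ℝ) * Complex.I) := by
  set phase : ℝ → ℂ := fun x => Complex.exp (SignType.sign x * θ * Complex.I) with hphase
  have hZ : Z * hermitianFun hG phase = Z := by
    have h := mul_hermitianFun_eq_zero hG (f := phase - 1) (by simp [hphase]) hZG
    rwa [map_sub, map_one, mul_sub, mul_one, sub_eq_zero] at h
  have hfactor : rotated Z hG θ = rotated Z hG 0 * hermitianFun hG phase := by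
    rw [rotated, rotated, add_mul, hZ, ← map_mul]
    congr 2
    ext x
    simp [hphase]
  rw [hfactor, Matrix.det_mul, det_hermitianFun]
  have cast_sign (s : SignType) : ((s : ℝ) : ℂ) = s := SignType.map_cast Complex.ofRealHom s
  simp only [hphase, ← Complex.exp_sum, ← Finset.sum_mul, signature]
  push_cast
  simp only [cast_sign]

theorem det_rotated_zero_ne_zero (hG : G.IsHermitian) (hGZ : G * Z = 0)
    (hker : ∀ v, Z *ᵥ v = 0 → G *ᵥ v = 0 → v = 0) : (rotated Z hG 0).det ≠ 0 := by
  set absG := hermitianFun hG fun x => ((|x| : ℝ) : ℂ) with habsG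
  have absG_isHermitian : absGᴴ = absG := by
    rw [habsG, ← Matrix.star_eq_conjTranspose, ← map_star]
    congr 1
    ext x
    simp
  have absG_mul_absG : absG * absG = Gᴴ * G := by
    rw [habsG, hG.eq, ← map_mul]
    conv_rhs => rw [← hermitianFun_ofReal hG, ← map_mul]
    congr 1
    ext x
    simp [← Complex.ofReal_mul]
  have absG_mul_Z : absG * Z = 0 := hermitianFun_mul_eq_zero hG (by simp) hGZ
  have rotated_zero : rotated Z hG 0 = Z + absG := by simp [rotated_eq_add_add, habsG]
  intro hdet
  obtain ⟨v, hv, hrot_v⟩ := Matrix.exists_mulVec_eq_zero_iff.mpr hdet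
  have absG_v : absG *ᵥ v = 0 := by
    have h := congrArg (absG *ᵥ ·) hrot_v
    simp only [rotated_zero, Matrix.mulVec_mulVec, mul_add, absG_mul_Z, zero_add,
      Matrix.mulVec_zero] at h
    rwa [← Matrix.conjTranspose_mul_self_mulVec_eq_zero, absG_isHermitian]
  refine hv (hker v ?_ ?_)
  · rwa [rotated_zero, Matrix.add_mulVec, absG_v, add_zero] at hrot_v
  · rw [← Matrix.conjTranspose_mul_self_mulVec_eq_zero, ← absG_mul_absG, ← Matrix.mulVec_mulVec,
      absG_v, Matrix.mulVec_zero]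

theorem rotated_mem_accretive (hG : G.IsHermitian) (hZ : ∀ v, 0 ≤ (star v ⬝ᵥ Z *ᵥ v).re)
    (hZG : Z * G = 0) (hGZ : G * Z = 0) (hker : ∀ v, Z *ᵥ v = 0 → G *ᵥ v = 0 → v = 0)
    {θ : ℝ} (hθ : θ ∈ Icc (-(Real.pi / 2)) (Real.pi / 2)) : rotated Z hG θ ∈ accretive k := by
  refine ⟨fun v => ?_, ?_⟩
  · rw [rotated, Matrix.add_mulVec, dotProduct_add, Complex.add_re]
    refine add_nonneg (hZ v) (re_dotProduct_hermitianFun_nonneg hG (fun x => ?_) v)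
    have hcos := Real.cos_nonneg_of_mem_Icc hθ
    have hre : (|x| * Complex.exp (SignType.sign x * θ * Complex.I)).re = Real.cos θ * |x| := by
      rw [abs_mul_exp_sign]
      simp [-Complex.ofReal_cos, -Complex.ofReal_sin]
    rw [hre]
    positivity
  · rw [det_rotated hG hZG]
    exact mul_ne_zero (det_rotated_zero_ne_zero hG hGZ hker) (Complex.exp_ne_zero _)

theorem argDet_rotated (hG : G.IsHermitian) (hZ : ∀ v, 0 ≤ (star v ⬝ᵥ Z *ᵥ v).re)
    (hZG : Z * G = 0) (hGZ : G * Z = 0) (hker : ∀ v, Z *ᵥ v = 0 → G *ᵥ v = 0 → v = 0)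
    {θ : ℝ} (hθ : θ ∈ Icc (-(Real.pi / 2)) (Real.pi / 2)) :
    argDet (rotated Z hG θ) = argDet (rotated Z hG 0) + signature hG * θ := by
  have h := argDet_sub_argDet (isPreconnected_Icc (a := -(Real.pi / 2)) (b := Real.pi / 2))
    (continuous_rotated Z hG).continuousOn
    (fun θ hθ => rotated_mem_accretive hG hZ hZG hGZ hker hθ)
    (φ := fun θ => signature hG * θ) (by fun_prop) (θ := (rotated Z hG 0).det.arg)
    (fun θ _ => ?_) (a := 0) (by simp [Real.pi_div_two_pos.le]) hθ
  · simp only [mul_zero, sub_zero] at h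
    linarith
  · rw [det_rotated hG hZG, Complex.arg_mul_coe_angle (det_rotated_zero_ne_zero hG hGZ hker)
      (Complex.exp_ne_zero _), add_comm, ← coe_im_of_exp_eq rfl]
    simp

theorem argDet_rotated_zero_zero (hG : G.IsHermitian) (hker : ∀ v, G *ᵥ v = 0 → v = 0) :
    argDet (rotated 0 hG 0) = 0 := by
  refine argDet_eq_zero_of_posDef ?_
  have hsqrt : (fun x : ℝ => ((|x| : ℝ) : ℂ)) =
      star (fun x : ℝ => ((√|x| : ℝ) : ℂ)) * fun x : ℝ => ((√|x| : ℝ) : ℂ) := by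
    ext x
    simp [← Complex.ofReal_mul]
  have hsq : rotated 0 hG 0 = (hermitianFun hG fun x => ((√|x| : ℝ) : ℂ))ᴴ *
      hermitianFun hG fun x => ((√|x| : ℝ) : ℂ) := by
    rw [← Matrix.star_eq_conjTranspose, ← map_star, ← map_mul, ← hsqrt]
    simp [rotated_eq_add_add]
  have hdet := det_rotated_zero_ne_zero hG (Z := 0) (mul_zero G) fun v _ => hker v
  rw [hsq] at hdet ⊢
  exact (Matrix.posSemidef_conjTranspose_mul_self _).posDef_iff_det_ne_zero.mpr hdet

end Rotation

/-! ### Sums of jumps -/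

section SumOfJumps

variable {g B c : ℝ → ℝ} {a b : ℝ}

theorem eventually_sign_sub_eq {t u : ℝ} (hut : u ≠ t) :
    ∀ᶠ s in 𝓝 t, SignType.sign (s - u) = SignType.sign (t - u) := by
  have hcont : ContinuousAt (fun s => SignType.sign (s - u)) t :=
    ContinuousAt.comp (g := SignType.sign) (continuousAt_sign_of_ne_zero (sub_ne_zero.mpr hut.symm))
      (continuousAt_id.sub continuousAt_const)
  exact hcont.eventually (p := (· = SignType.sign (t - u))) (by rw [nhds_discrete]; rfl)

theorem eventually_sum_mul_sign_sub_eq (S : Finset ℝ) {t : ℝ} (ht : c t ≠ 0 → t ∈ S) :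
    ∀ᶠ s in 𝓝 t, ∑ u ∈ S, c u * (SignType.sign (s - u) : ℝ) =
      ∑ u ∈ S, c u * (SignType.sign (t - u) : ℝ) + c t * (SignType.sign (s - t) : ℝ) := by
  have hsign : ∀ᶠ s in 𝓝 t, ∀ u ∈ S, u ≠ t →
      SignType.sign (s - u) = SignType.sign (t - u) := by
    refine (eventually_all_finset S).mpr fun u _ => ?_
    by_cases hut : u = t
    · exact .of_forall fun _ hne => absurd hut hne
    · exact (eventually_sign_sub_eq hut).mono fun _ hs _ => hs
  filter_upwards [hsign] with s hs
  have hsingle : c t * (SignType.sign (s - t) : ℝ) =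
      ∑ u ∈ S, if u = t then c t * (SignType.sign (s - t) : ℝ) else 0 := by
    rw [Finset.sum_ite_eq']
    split_ifs with htS
    · rfl
    · rw [of_not_not (mt ht htS), zero_mul]
  rw [hsingle, ← Finset.sum_add_distrib]
  refine Finset.sum_congr rfl fun u hu => ?_
  by_cases hut : u = t
  · simp [hut]
  · rw [hs u hu hut, if_neg hut, add_zero]

/-- `g` is constant on each side of every point of `[a, b]`, with mean value `B t` and jump
`-2 c t` at `t`; at an end point only one side is seen. -/
def HasJumps (g B c : ℝ → ℝ) (a b : ℝ) : Prop :=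
  ∀ t ∈ Icc a b, ∀ᶠ s in 𝓝[Icc a b \ {t}] t, g s = B t - (SignType.sign (s - t) : ℝ) * c t

theorem HasJumps.eq_of_eventually_eq (hg : HasJumps g B c a b) {s v : ℝ} (hs : s ∈ Ioo a b)
    (hv : ∀ᶠ r in 𝓝[≠] s, g r = v) : c s = 0 ∧ B s = v := by
  have hboth : ∀ᶠ r in 𝓝[≠] s, v = B s - (SignType.sign (r - s) : ℝ) * c s := by
    have hnhds : 𝓝[Icc a b \ {s}] s = 𝓝[≠] s := by
      rw [sdiff_eq]
      exact nhdsWithin_inter_of_mem (mem_nhdsWithin_of_mem_nhds (Icc_mem_nhds hs.1 hs.2))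
    filter_upwards [hnhds ▸ hg s (Ioo_subset_Icc_self hs), hv] with r hr hrv
    rw [← hr, hrv]
  obtain ⟨r, hr, hsr⟩ := ((hboth.filter_mono (nhdsGT_le_nhdsNE s)).and
    (self_mem_nhdsWithin : Ioi s ∈ 𝓝[>] s)).exists
  obtain ⟨r', hr', hsr'⟩ := ((hboth.filter_mono (nhdsLT_le_nhdsNE s)).and
    (self_mem_nhdsWithin : Iio s ∈ 𝓝[<] s)).exists
  rw [sign_pos (sub_pos.mpr hsr)] at hr
  rw [sign_neg (sub_neg.mpr hsr')] at hr'
  simp only [SignType.coe_one, SignType.coe_neg, one_mul, neg_one_mul] at hr hr'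
  constructor <;> linarith

theorem eventually_mem_Ioo_nhdsWithin_Icc_diff (a b t : ℝ) :
    ∀ᶠ s in 𝓝[Icc a b \ {t}] t, s ∈ Ioo a b := by
  have hne : ∀ e, ∀ᶠ s in 𝓝[Icc a b \ {t}] t, s ≠ e := fun e => by
    rcases eq_or_ne e t with rfl | he
    · exact eventually_mem_nhdsWithin.mono fun _ hs => hs.2
    · exact nhdsWithin_le_nhds (isOpen_ne.mem_nhds he.symm)
  filter_upwards [hne a, hne b, self_mem_nhdsWithin] with s hsa hsb hs
  exact ⟨hs.1.1.lt_of_ne hsa.symm, hs.1.2.lt_of_ne hsb⟩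

theorem HasJumps.eventually_eq (hg : HasJumps g B c a b) {t : ℝ} (ht : t ∈ Icc a b) :
    ∀ᶠ s in 𝓝[Icc a b \ {t}] t, c s = 0 ∧ B s = B t - (SignType.sign (s - t) : ℝ) * c t := by
  filter_upwards [eventually_eventually_nhdsWithin.mpr (hg t ht), self_mem_nhdsWithin,
    eventually_mem_Ioo_nhdsWithin_Icc_diff a b t] with s hs hst hsab
  refine hg.eq_of_eventually_eq hsab ?_
  have hmem : Icc a b \ {t} ∈ 𝓝 s :=
    inter_mem (Icc_mem_nhds hsab.1 hsab.2) (isOpen_ne.mem_nhds hst.2)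
  rw [nhdsWithin_eq_nhds.mpr hmem] at hs
  refine nhdsWithin_le_nhds ?_
  filter_upwards [hs, eventually_sign_sub_eq (Ne.symm hst.2)] with r hr hrt
  rw [hr, hrt]

theorem HasJumps.finite_support (hg : HasJumps g B c a b) :
    (Ioo a b ∩ Function.support c).Finite := by
  by_contra hinf
  obtain ⟨t, ht, hacc⟩ := Set.Infinite.exists_accPt_of_subset_isCompact hinf isCompact_Icc
    (inter_subset_left.trans Ioo_subset_Icc_self)
  refine (accPt_iff_frequently_nhdsNE.mp hacc) ?_
  have hc := hg.eventually_eq ht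
  rw [sdiff_eq, inter_comm, nhdsWithin_inter', eventually_inf_principal] at hc
  filter_upwards [hc] with s hs hs'
  exact hs'.2 (hs (Ioo_subset_Icc_self hs'.1)).1

/-- The jumps of the step function `∑ c u * sign (t - u)` cancel those of `B`. -/
theorem HasJumps.add_sum_mul_sign_eq (hg : HasJumps g B c a b) {S : Finset ℝ}
    (hS : ∀ u ∈ Icc a b, c u ≠ 0 → u ∈ S) {t : ℝ} (ht : t ∈ Icc a b) :
    B t + ∑ u ∈ S, c u * (SignType.sign (t - u) : ℝ) =
      B a + ∑ u ∈ S, c u * (SignType.sign (a - u) : ℝ) := by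
  set f : ℝ → ℝ := fun t => B t + ∑ u ∈ S, c u * (SignType.sign (t - u) : ℝ) with hf
  have hloc : ∀ t ∈ Icc a b, f =ᶠ[𝓝[Icc a b] t] fun _ => f t := fun t ht => by
    have hB := hg.eventually_eq ht
    rw [sdiff_eq, nhdsWithin_inter', eventually_inf_principal] at hB
    filter_upwards [hB, nhdsWithin_le_nhds (eventually_sum_mul_sign_sub_eq S (hS t ht))]
      with s hBs hsum
    by_cases hst : s = t
    · rw [hst]
    · simp only [hf, hsum, (hBs hst).2]
      ring
  have hderiv : ∀ t ∈ Icc a b, HasDerivWithinAt f 0 (Icc a b) t := fun t ht =>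
    (hasDerivWithinAt_const t _ (f t)).congr_of_eventuallyEq (hloc t ht) rfl
  exact constant_of_has_deriv_right_zero
    (fun t ht => (hderiv t ht).continuousWithinAt)
    (fun t ht => (hderiv t (Ico_subset_Icc_self ht)).mono_of_mem_nhdsWithin
      (Icc_mem_nhdsGE_of_mem ht)) t ht

theorem HasJumps.sub_eq (hg : HasJumps g B c a b) (hab : a < b) :
    B b - B a = -c a - c b - 2 * ∑ᶠ t ∈ Ioo a b, c t := by
  have hsum : ∑ᶠ t ∈ Ioo a b, c t = ∑ u ∈ hg.finite_support.toFinset, c u := by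
    rw [← finsum_mem_inter_support]
    exact finsum_mem_eq_finite_toFinset_sum c hg.finite_support
  set S := hg.finite_support.toFinset with hSdef
  have hmem : ∀ u, u ∈ S ↔ u ∈ Ioo a b ∧ c u ≠ 0 := fun u => by simp [hSdef]
  have hbS : b ∉ S := fun h => lt_irrefl _ ((hmem b).mp h).1.2
  have haS : a ∉ insert b S := by
    simp only [Finset.mem_insert, hab.ne, hmem, mem_Ioo, lt_irrefl, false_and, or_self,
      not_false_eq_true]
  have hconst := hg.add_sum_mul_sign_eq (S := insert a (insert b S)) (fun u hu hcu => by
    simp only [Finset.mem_insert, hmem, mem_Ioo]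
    rcases eq_or_lt_of_le hu.1 with h | h
    · exact .inl h.symm
    rcases eq_or_lt_of_le hu.2 with h' | h'
    · exact .inr (.inl h')
    · exact .inr (.inr ⟨⟨h, h'⟩, hcu⟩)) (right_mem_Icc.mpr hab.le)
  have hb : ∑ u ∈ S, c u * (SignType.sign (b - u) : ℝ) = ∑ u ∈ S, c u :=
    Finset.sum_congr rfl fun u hu => by
      rw [sign_pos (sub_pos.mpr ((hmem u).mp hu).1.2), SignType.coe_one, mul_one]
  have ha : ∑ u ∈ S, c u * (SignType.sign (a - u) : ℝ) = -∑ u ∈ S, c u := by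
    rw [← Finset.sum_neg_distrib]
    exact Finset.sum_congr rfl fun u hu => by
      rw [sign_neg (sub_neg.mpr ((hmem u).mp hu).1.1), SignType.coe_neg_one, mul_neg_one]
  rw [Finset.sum_insert haS, Finset.sum_insert hbS, Finset.sum_insert haS, Finset.sum_insert hbS,
    hb, ha, sub_self, sub_self, sign_pos (sub_pos.mpr hab), sign_neg (sub_neg.mpr hab)] at hconst
  simp only [sign_zero, SignType.coe_one, SignType.coe_neg_one, SignType.coe_zero] at hconst
  rw [hsum]
  linarith

end SumOfJumps

/-! ### The fixed space of a unitary matrix -/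

section FixedProjection

variable {k : Type*} [Fintype k] [DecidableEq k] {A P : Matrix k k ℂ}

/-- The orthogonal projection onto the fixed space `{v | A v = v}` of the matrix `A`. -/
def fixedProjection (A : Matrix k k ℂ) : Matrix k k ℂ :=
  (Matrix.toEuclideanCLM (𝕜 := ℂ)).symm
    (LinearMap.ker (Matrix.toEuclideanCLM (𝕜 := ℂ) A - 1).toLinearMap).starProjection

theorem isStarProjection_fixedProjection (A : Matrix k k ℂ) :
    IsStarProjection (fixedProjection A) :=
  ⟨isStarProjection_starProjection.isIdempotentElem.map (Matrix.toEuclideanCLM (𝕜 := ℂ)).symm,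
    ((Matrix.toEuclideanCLM (n := k) (𝕜 := ℂ)).symm.map_star' _).symm.trans
      (congrArg _ isStarProjection_starProjection.isSelfAdjoint)⟩

theorem fixedProjection_mulVec_eq_self_iff {v : k → ℂ} :
    fixedProjection A *ᵥ v = v ↔ A *ᵥ v = v := by
  have hmulVec : ∀ M : Matrix k k ℂ,
      M *ᵥ v = v ↔ Matrix.toEuclideanCLM (𝕜 := ℂ) M (WithLp.toLp 2 v) = WithLp.toLp 2 v :=
    fun M => by rw [Matrix.toEuclideanCLM_toLp, (WithLp.toLp_injective 2).eq_iff]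
  rw [hmulVec, hmulVec, fixedProjection, StarAlgEquiv.apply_symm_apply,
    Submodule.starProjection_eq_self_iff, LinearMap.mem_ker]
  exact sub_eq_zero

theorem mul_fixedProjection (A : Matrix k k ℂ) : A * fixedProjection A = fixedProjection A :=
  Matrix.ext_of_mulVec_single fun j => by
    rw [← Matrix.mulVec_mulVec, ← fixedProjection_mulVec_eq_self_iff, Matrix.mulVec_mulVec,
      (isStarProjection_fixedProjection A).isIdempotentElem.eq]

theorem fixedProjection_mul (hA : Aᴴ * A = 1) : fixedProjection A * A = fixedProjection A := by
  have hconj : Aᴴ * fixedProjection A = fixedProjection A := by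
    conv_lhs => rw [← mul_fixedProjection A, ← mul_assoc, hA, one_mul]
  have hself : (fixedProjection A)ᴴ = fixedProjection A :=
    (isStarProjection_fixedProjection A).isSelfAdjoint
  simpa only [Matrix.conjTranspose_mul, Matrix.conjTranspose_conjTranspose, hself] using
    congrArg Matrix.conjTranspose hconj

theorem one_sub_add_smul_mul (hP : IsIdempotentElem P) (x y : ℝ) :
    (1 - P + x • P) * (1 - P + y • P) = 1 - P + (x * y) • P := by
  simp only [add_mul, mul_add, hP.one_sub.eq, smul_mul_assoc, mul_smul_comm, hP.mul_one_sub_self,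
    hP.one_sub_mul_self, hP.eq, smul_zero, add_zero, zero_add, smul_smul, mul_comm y]

theorem posDef_one_sub_add_smul (hP : IsStarProjection P) {x : ℝ} (hx : 0 < x) :
    (1 - P + x • P).PosDef := by
  have hself : (1 - P + √x • P)ᴴ = 1 - P + √x • P :=
    hP.one_sub.isSelfAdjoint.add ((IsSelfAdjoint.all √x).smul hP.isSelfAdjoint)
  have hsq : (1 - P + √x • P)ᴴ * (1 - P + √x • P) = 1 - P + x • P := by
    rw [hself, one_sub_add_smul_mul hP.isIdempotentElem, Real.mul_self_sqrt hx.le]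
  refine (hsq ▸ Matrix.posSemidef_conjTranspose_mul_self _).posDef_iff_isUnit.mpr ?_
  refine .of_mul_eq_one (1 - P + x⁻¹ • P) ?_
  rw [one_sub_add_smul_mul hP.isIdempotentElem, mul_inv_cancel₀ hx.ne', one_smul, sub_add_cancel]

end FixedProjection

/-! ### Signatures of quadratic forms -/

section Signature

theorem sigPos_comp_le {E F : Type*} [AddCommGroup E] [Module ℝ E] [FiniteDimensional ℝ E]
    [AddCommGroup F] [Module ℝ F] [FiniteDimensional ℝ F] (Q : QuadraticForm ℝ F) (f : E →ₗ[ℝ] F) :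
    sigPos (Q.comp f) ≤ sigPos Q := by
  obtain ⟨V, hfinrank, hpos⟩ := exists_finrank_eq_sigPos_and_posDef (Q.comp f)
  have hinj : Function.Injective (f.domRestrict V) := by
    refine (injective_iff_map_eq_zero _).mpr fun v hv => ?_
    by_contra hne
    refine (hpos v hne).ne' ?_
    change Q (f.domRestrict V v) = 0
    rw [hv, QuadraticMap.map_zero]
  rw [← hfinrank, ← LinearMap.finrank_range_of_inj hinj]
  refine le_sigPos_of_posDef Q fun ⟨_, v, hv⟩ hne => ?_
  subst hv
  exact hpos v fun h0 => hne (Subtype.ext (by simp [h0]))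

theorem sigPos_comp_of_surjective {E F : Type*} [AddCommGroup E] [Module ℝ E]
    [FiniteDimensional ℝ E] [AddCommGroup F] [Module ℝ F] [FiniteDimensional ℝ F]
    (Q : QuadraticForm ℝ F) {f : E →ₗ[ℝ] F} (hf : Function.Surjective f) :
    sigPos (Q.comp f) = sigPos Q := by
  obtain ⟨g, hg⟩ := f.exists_rightInverse_of_surjective (LinearMap.range_eq_top.mpr hf)
  refine (sigPos_comp_le Q f).antisymm ?_
  have hQ : (Q.comp f).comp g = Q := QuadraticMap.ext fun v => congrArg Q (LinearMap.congr_fun hg v)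
  conv_lhs => rw [← hQ]
  exact sigPos_comp_le (Q.comp f) g

theorem sigNeg_comp_of_surjective {E F : Type*} [AddCommGroup E] [Module ℝ E]
    [FiniteDimensional ℝ E] [AddCommGroup F] [Module ℝ F] [FiniteDimensional ℝ F]
    (Q : QuadraticForm ℝ F) {f : E →ₗ[ℝ] F} (hf : Function.Surjective f) :
    sigNeg (Q.comp f) = sigNeg Q :=
  sigPos_comp_of_surjective (-Q) hf

variable {k : Type*} [Fintype k] [DecidableEq k] {G : Matrix k k ℂ}

theorem signature_eq_ncard_sub_ncard (hG : G.IsHermitian) :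
    signature hG = ({j | 0 < hG.eigenvalues j}.ncard : ℤ) - {j | hG.eigenvalues j < 0}.ncard := by
  have hsign : ∀ x : ℝ, ((SignType.sign x : SignType) : ℤ) =
      (if 0 < x then 1 else 0) - if x < 0 then 1 else 0 := fun x => by
    rcases lt_trichotomy x 0 with h | rfl | h
    · simp [h, h.not_gt]
    · simp
    · simp [h, h.not_gt]
  simp only [signature, hsign, Finset.sum_sub_distrib, Finset.sum_boole,
    Set.ncard_eq_toFinset_card', Set.toFinset_ofPred]

/-- The real and imaginary parts of the coordinates in an eigenbasis of `G`. -/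
def eigenCoordinates (hG : G.IsHermitian) : (k → ℂ) ≃ₗ[ℝ] (k × Fin 2 → ℝ) :=
  ((Matrix.UnitaryGroup.toLinearEquiv (star hG.eigenvectorUnitary)).restrictScalars ℝ).trans
    ((LinearEquiv.piCongrRight fun _ => Complex.basisOneI.equivFun).trans
      (LinearEquiv.curry ℝ ℝ k (Fin 2)).symm)

theorem re_dotProduct_mulVec_eq_weightedSumSquares (hG : G.IsHermitian) (v : k → ℂ) :
    (star v ⬝ᵥ G *ᵥ v).re =
      QuadraticMap.weightedSumSquares ℝ (fun i : k × Fin 2 => hG.eigenvalues i.1)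
        (eigenCoordinates hG v) := by
  conv_lhs => rw [← hermitianFun_ofReal hG]
  rw [dotProduct_hermitianFun_mulVec, QuadraticMap.weightedSumSquares_apply,
    Fintype.sum_prod_type, Complex.re_sum]
  refine Finset.sum_congr rfl fun j _ => ?_
  rw [Fin.sum_univ_two, ← Complex.ofReal_mul, Complex.ofReal_re, Complex.sq_norm,
    Complex.normSq_apply, mul_add]
  rfl

theorem sigPos_sub_sigNeg_eq_two_mul_signature (hG : G.IsHermitian)
    {Q : QuadraticForm ℝ (k → ℂ)} (hQ : ∀ v, Q v = (star v ⬝ᵥ G *ᵥ v).re) :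
    (sigPos Q : ℤ) - sigNeg Q = 2 * signature hG := by
  have hequiv : Q.Equivalent
      (QuadraticMap.weightedSumSquares ℝ fun i : k × Fin 2 => hG.eigenvalues i.1) :=
    ⟨⟨eigenCoordinates hG, fun v => by
      rw [hQ, re_dotProduct_mulVec_eq_weightedSumSquares hG]; rfl⟩⟩
  have hncard : ∀ p : ℝ → Prop, {i : k × Fin 2 | p (hG.eigenvalues i.1)}.ncard =
      {j | p (hG.eigenvalues j)}.ncard * 2 := fun p => by
    rw [show {i : k × Fin 2 | p (hG.eigenvalues i.1)} = {j | p (hG.eigenvalues j)} ×ˢ univ by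
      ext; simp, Set.ncard_prod, Set.ncard_univ, Nat.card_fin]
  rw [QuadraticForm.sigPos_of_equiv_weightedSumSquares hequiv,
    QuadraticForm.sigNeg_of_equiv_weightedSumSquares hequiv, hncard (0 < ·), hncard (· < 0),
    signature_eq_ncard_sub_ncard]
  push_cast
  ring

end Signature

/-! ### The crossing form of a path of unitary matrices -/

section Crossing

variable {k : Type*} [Fintype k]

/-- A path of complex matrices, as a path of real linear maps. -/
def matrixPath (ψ : ℝ → Matrix k k ℂ) (t : ℝ) : (k → ℂ) →L[ℝ] (k → ℂ) :=
  LinearMap.toContinuousLinearMap ((ψ t).mulVecLin.restrictScalars ℝ)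

variable {ψ : ℝ → Matrix k k ℂ} {ψ' : Matrix k k ℂ} {t : ℝ}

theorem mem_crossingSpace_matrixPath {v : k → ℂ} :
    v ∈ crossingSpace (matrixPath ψ) t ↔ ψ t *ᵥ v = v := by
  simp [crossingSpace, matrixPath, sub_eq_zero]

theorem deriv_matrixPath_apply (hψ : HasDerivAt ψ ψ' t) (v : k → ℂ) :
    deriv (matrixPath ψ) t v = ψ' *ᵥ v := by
  classical
  let L : Matrix k k ℂ →ₗ[ℝ] (k → ℂ) →L[ℝ] (k → ℂ) :=
    LinearMap.toContinuousLinearMap.toLinearMap ∘ₗ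
      LinearMap.restrictScalarsₗ ℝ ℂ (k → ℂ) (k → ℂ) ℝ ∘ₗ
        (Matrix.toLin' (R := ℂ)).toLinearMap.restrictScalars ℝ
  open scoped Matrix.Norms.L2Operator in
  have hderiv : HasDerivAt (matrixPath ψ) (L ψ') t :=
    (LinearMap.toContinuousLinearMap L).hasFDerivAt.comp_hasDerivAt t hψ
  rw [hderiv.deriv]
  rfl

theorem crossingForm_matrixPath_apply (hψ : HasDerivAt ψ ψ' t)
    (v : crossingSpace (matrixPath ψ) t) :
    crossingForm (matrixPath ψ) t v = (star (v : k → ℂ) ⬝ᵥ ψ' *ᵥ (v : k → ℂ)).im := by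
  change stdSymp k v (deriv (matrixPath ψ) t v) = _
  rw [deriv_matrixPath_apply hψ]
  rfl

variable [DecidableEq k]

/-- If `A` is the value and `A'` the derivative of a path of unitary matrices, this is the Hermitian
matrix `-i A'`, compressed to the fixed space of `A`. -/
def crossingMatrix (A A' : Matrix k k ℂ) : Matrix k k ℂ :=
  -Complex.I • (fixedProjection A * A' * fixedProjection A)

variable {A A' : Matrix k k ℂ}

theorem I_smul_crossingMatrix :
    Complex.I • crossingMatrix A A' = fixedProjection A * A' * fixedProjection A := by
  rw [crossingMatrix, smul_smul, mul_neg, Complex.I_mul_I, neg_neg, one_smul]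

theorem mul_crossingMatrix : A * crossingMatrix A A' = crossingMatrix A A' := by
  rw [crossingMatrix, mul_smul_comm, ← mul_assoc, ← mul_assoc, mul_fixedProjection]

theorem crossingMatrix_mul (hA : Aᴴ * A = 1) : crossingMatrix A A' * A = crossingMatrix A A' := by
  rw [crossingMatrix, smul_mul_assoc, mul_assoc, fixedProjection_mul hA]

theorem isHermitian_crossingMatrix (hskew : A'ᴴ * A + Aᴴ * A' = 0) :
    (crossingMatrix A A').IsHermitian := by
  set P := fixedProjection A with hP
  have hself : Pᴴ = P := (isStarProjection_fixedProjection A).isSelfAdjoint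
  have hPA : P * Aᴴ = P := by
    rw [← hself, ← Matrix.conjTranspose_mul, mul_fixedProjection]
  have hcompressed : P * A'ᴴ * P = -(P * A' * P) := by
    have h : P * A'ᴴ * (A * P) + P * Aᴴ * (A' * P) = 0 := by
      simpa only [mul_add, add_mul, mul_assoc, mul_zero, zero_mul] using
        congrArg (fun M => P * M * P) hskew
    rw [mul_fixedProjection, hPA, ← mul_assoc] at h
    exact eq_neg_of_add_eq_zero_left h
  rw [Matrix.IsHermitian, crossingMatrix, Matrix.conjTranspose_smul, Matrix.conjTranspose_mul,
    Matrix.conjTranspose_mul, ← hP, hself, ← mul_assoc, hcompressed]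
  simp only [star_neg, Complex.star_def, Complex.conj_I, neg_neg, smul_neg, neg_smul]

theorem re_dotProduct_crossingMatrix (v : k → ℂ) :
    (star v ⬝ᵥ crossingMatrix A A' *ᵥ v).re =
      (star (fixedProjection A *ᵥ v) ⬝ᵥ A' *ᵥ (fixedProjection A *ᵥ v)).im := by
  have hself : (fixedProjection A)ᴴ = fixedProjection A :=
    (isStarProjection_fixedProjection A).isSelfAdjoint
  rw [Matrix.star_mulVec, hself, ← Matrix.dotProduct_mulVec, crossingMatrix, Matrix.smul_mulVec,
    dotProduct_smul, Matrix.mulVec_mulVec, Matrix.mulVec_mulVec]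
  simp

theorem crossingSign_matrixPath (hψ : HasDerivAt ψ ψ' t)
    (hG : (crossingMatrix (ψ t) ψ').IsHermitian) :
    crossingSign (matrixPath ψ) t = 2 * signature hG := by
  have hmem : ∀ v, ((fixedProjection (ψ t)).mulVecLin.restrictScalars ℝ) v ∈
      crossingSpace (matrixPath ψ) t := fun v => mem_crossingSpace_matrixPath.mpr <| by
    simp only [LinearMap.restrictScalars_apply, Matrix.mulVecLin_apply, Matrix.mulVec_mulVec,
      mul_fixedProjection]
  set toFixed := LinearMap.codRestrict _ _ hmem
  have hsurj : Function.Surjective toFixed := fun v => ⟨v, Subtype.ext <|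
    fixedProjection_mulVec_eq_self_iff.mpr (mem_crossingSpace_matrixPath.mp v.2)⟩
  rw [crossingSign, ← sigPos_comp_of_surjective _ hsurj, ← sigNeg_comp_of_surjective _ hsurj]
  refine sigPos_sub_sigNeg_eq_two_mul_signature hG fun v => ?_
  rw [QuadraticMap.comp_apply, crossingForm_matrixPath_apply hψ, re_dotProduct_crossingMatrix]
  rfl

theorem eq_zero_of_crossingMatrix_mulVec_eq_zero (hψ : HasDerivAt ψ ψ' t)
    (hG : (crossingMatrix (ψ t) ψ').IsHermitian)
    (hreg : (QuadraticMap.polarBilin (crossingForm (matrixPath ψ) t)).SeparatingLeft)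
    {v : k → ℂ} (hv : ψ t *ᵥ v = v) (hGv : crossingMatrix (ψ t) ψ' *ᵥ v = 0) : v = 0 := by
  set G := crossingMatrix (ψ t) ψ'
  have hform : ∀ u : crossingSpace (matrixPath ψ) t,
      crossingForm (matrixPath ψ) t u = (star (u : k → ℂ) ⬝ᵥ G *ᵥ (u : k → ℂ)).re := fun u => by
    rw [crossingForm_matrixPath_apply hψ, re_dotProduct_crossingMatrix,
      fixedProjection_mulVec_eq_self_iff.mpr (mem_crossingSpace_matrixPath.mp u.2)]
  have hvG : ∀ u, star v ⬝ᵥ G *ᵥ u = 0 := fun u => by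
    rw [Matrix.dotProduct_mulVec, ← hG.eq, ← Matrix.star_mulVec, hGv, star_zero, zero_dotProduct]
  refine congrArg Subtype.val (hreg ⟨v, mem_crossingSpace_matrixPath.mpr hv⟩ fun u => ?_)
  rw [QuadraticMap.polarBilin_apply_apply, QuadraticMap.polar, hform, hform, hform]
  simp only [Submodule.coe_add, Matrix.mulVec_add, hGv, zero_add, star_add, add_dotProduct,
    hvG, dotProduct_zero, Complex.zero_re, sub_zero, sub_self]

end Crossing

/-! ### The Robbin–Salamon index of a loop of unitary matrices -/

section UnitaryLoop

variable {k : Type*} [Fintype k] [DecidableEq k] {A P : Matrix k k ℂ}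
  {ψ : ℝ → Matrix k k ℂ} {ψ' : Matrix k k ℂ} {t l : ℝ}

theorem re_dotProduct_one_sub_mulVec_nonneg (hA : Aᴴ * A = 1) (v : k → ℂ) :
    0 ≤ (star v ⬝ᵥ (1 - A) *ᵥ v).re := by
  have hsq : (1 - A)ᴴ * (1 - A) = (1 - A) + (1 - A)ᴴ := by
    simp only [Matrix.conjTranspose_sub, Matrix.conjTranspose_one, mul_sub, sub_mul, mul_one,
      one_mul, hA]
    abel
  have hconj : star v ⬝ᵥ (1 - A)ᴴ *ᵥ v = conj (star v ⬝ᵥ (1 - A) *ᵥ v) := by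
    rw [← Complex.star_def, ← Matrix.star_dotProduct_star, star_star, Matrix.star_mulVec,
      Matrix.dotProduct_mulVec]
  have hnonneg := (Complex.nonneg_iff.mp
    ((Matrix.posSemidef_conjTranspose_mul_self (1 - A)).dotProduct_mulVec_nonneg v)).1
  rw [hsq, Matrix.add_mulVec, dotProduct_add, hconj, Complex.add_re, Complex.conj_re] at hnonneg
  linarith

open scoped Matrix.Norms.L2Operator in
theorem conjTranspose_mul_add_eq_zero_of_unitary {S : Set ℝ} (hψ : HasDerivAt ψ ψ' t)
    (hunit : ∀ s ∈ S, (ψ s)ᴴ * ψ s = 1) (ht : t ∈ S) (hS : UniqueDiffWithinAt ℝ S t) :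
    ψ'ᴴ * ψ t + (ψ t)ᴴ * ψ' = 0 :=
  hS.eq_deriv _ (hψ.star.mul hψ).hasDerivWithinAt
    ((hasDerivWithinAt_const t S (1 : Matrix k k ℂ)).congr hunit (hunit t ht))

theorem one_sub_add_smul_mul_sub_smul_mul {Z : Matrix k k ℂ} (hPZ : P * Z = 0) (hZP : Z * P = 0)
    (R : Matrix k k ℂ) (x d : ℝ) :
    (1 - P + x • P) * (Z - d • R) * (1 - P + x • P) =
      Z - d • ((1 - P) * R * (1 - P)) - (d * x) • (P * R * (1 - P) + (1 - P) * R * P) -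
        (d * x * x) • (P * R * P) := by
  have hstretchZ : (1 - P + x • P) * Z * (1 - P + x • P) = Z := by
    simp only [add_mul, sub_mul, mul_add, mul_sub, smul_mul_assoc, mul_smul_comm, one_mul, mul_one,
      hPZ, hZP, smul_zero, add_zero, sub_zero]
  rw [mul_sub, sub_mul, hstretchZ]
  simp only [add_mul, mul_add, smul_mul_assoc, mul_smul_comm]
  module

/-- The dilation by `|d|^{-1/2}` of the fixed space of `A`, the identity on its orthogonal
complement. At `d = s - t` it makes the variation of `1 - ψ s` on the fixed space of `ψ t`
visible in the limit. -/
def stretch (A : Matrix k k ℂ) (d : ℝ) : Matrix k k ℂ :=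
  1 - fixedProjection A + (√|d|)⁻¹ • fixedProjection A

theorem posDef_stretch (A : Matrix k k ℂ) {d : ℝ} (hd : d ≠ 0) : (stretch A d).PosDef :=
  posDef_one_sub_add_smul (isStarProjection_fixedProjection A)
    (inv_pos.mpr (Real.sqrt_pos.mpr (abs_pos.mpr hd)))

theorem stretch_mul_one_sub_mul_stretch (ht : (ψ t)ᴴ * ψ t = 1) {s : ℝ} (hs : s ≠ t) :
    stretch (ψ t) (s - t) * (1 - ψ s) * stretch (ψ t) (s - t) =
      letI P := fixedProjection (ψ t)
      letI R := slope ψ t s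
      1 - ψ t - (s - t) • ((1 - P) * R * (1 - P)) -
        ((SignType.sign (s - t) : ℝ) * √|s - t|) • (P * R * (1 - P) + (1 - P) * R * P) -
        (SignType.sign (s - t) : ℝ) • (P * R * P) := by
  have hr : √|s - t| ≠ 0 := (Real.sqrt_pos.mpr (abs_pos.mpr (sub_ne_zero.mpr hs))).ne'
  have hd : s - t = (SignType.sign (s - t) : ℝ) * (√|s - t| * √|s - t|) := by
    rw [Real.mul_self_sqrt (abs_nonneg _), sign_mul_abs]
  have hdr : (s - t) * (√|s - t|)⁻¹ = (SignType.sign (s - t) : ℝ) * √|s - t| := by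
    rw [mul_inv_eq_iff_eq_mul₀ hr, mul_assoc, ← hd]
  have hslope : 1 - ψ s = 1 - ψ t - (s - t) • slope ψ t s := by
    rw [sub_smul_slope, vsub_eq_sub]
    abel
  rw [hslope, stretch, one_sub_add_smul_mul_sub_smul_mul, hdr, mul_inv_cancel_right₀ hr]
  · rw [mul_sub, mul_one, fixedProjection_mul ht, sub_self]
  · rw [sub_mul, one_mul, mul_fixedProjection, sub_self]

open scoped Matrix.Norms.L2Operator in
theorem tendsto_stretch_mul_one_sub_mul_stretch (hψ : HasDerivAt ψ ψ' t)
    (ht : (ψ t)ᴴ * ψ t = 1) {F : Filter ℝ} (hF : F ≤ 𝓝[≠] t) {σ : SignType}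
    (hσ : ∀ᶠ s in F, SignType.sign (s - t) = σ) :
    Tendsto (fun s => stretch (ψ t) (s - t) * (1 - ψ s) * stretch (ψ t) (s - t)) F
      (𝓝 (1 - ψ t - (σ : ℝ) • Complex.I • crossingMatrix (ψ t) ψ')) := by
  have hslope : Tendsto (slope ψ t) F (𝓝 ψ') :=
    (hasDerivAt_iff_tendsto_slope.mp hψ).mono_left hF
  have hmul : ∀ B C : Matrix k k ℂ, Tendsto (fun s => B * slope ψ t s * C) F (𝓝 (B * ψ' * C)) :=
    fun B C => (tendsto_const_nhds.mul hslope).mul tendsto_const_nhds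
  have hsub : Tendsto (fun s => s - t) F (𝓝 0) :=
    ((continuous_id.sub continuous_const).tendsto' t 0 (sub_self t)).mono_left
      (hF.trans nhdsWithin_le_nhds)
  have hsqrt : Tendsto (fun s => (σ : ℝ) * √|s - t|) F (𝓝 0) := by
    simpa using ((Real.continuous_sqrt.comp continuous_abs).tendsto 0 |>.comp hsub).const_mul
      (σ : ℝ)
  generalize hP : fixedProjection (ψ t) = P
  have hlim := ((tendsto_const_nhds (x := 1 - ψ t)).sub (hsub.smul (hmul (1 - P) (1 - P)))).sub
    (hsqrt.smul ((hmul P (1 - P)).add (hmul (1 - P) P))) |>.sub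
    ((tendsto_const_nhds (x := (σ : ℝ))).smul (hmul P P))
  rw [zero_smul, zero_smul, sub_zero, sub_zero] at hlim
  rw [I_smul_crossingMatrix, hP]
  refine hlim.congr' ?_
  filter_upwards [hσ, hF self_mem_nhdsWithin] with s hs hst
  rw [stretch_mul_one_sub_mul_stretch ht hst, hs, hP]

theorem coe_two_mul_argDet_one_sub_sub (hA : Aᴴ * A = 1) (hmem : 1 - A ∈ accretive k) {θ : ℝ}
    (hθ : A.det = Complex.exp (θ * Complex.I)) :
    ((2 * argDet (1 - A) - θ : ℝ) : Real.Angle) = (Fintype.card k * Real.pi : ℝ) := by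
  have hreflect : 1 - A = (-1 : ℂ) • (A * (1 - A)ᴴ) := by
    simp [mul_sub, mul_eq_one_comm.mp hA]
  have hdet : (1 - A).det =
      Complex.exp ((Fintype.card k * Real.pi + θ : ℝ) * Complex.I) * conj (1 - A).det := by
    conv_lhs => rw [hreflect]
    rw [Matrix.det_smul, Matrix.det_mul, Matrix.det_conjTranspose, hθ, ← Complex.exp_pi_mul_I,
      ← Complex.exp_nat_mul, ← mul_assoc, ← Complex.exp_add]
    push_cast
    ring_nf
    rfl
  have harg : ((1 - A).det.arg : Real.Angle) =
      (Fintype.card k * Real.pi + θ : ℝ) - (1 - A).det.arg := by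
    conv_lhs => rw [hdet]
    rw [Complex.arg_mul_coe_angle (Complex.exp_ne_zero _) ((map_ne_zero _).mpr hmem.2),
      Complex.arg_conj_coe_angle, ← coe_im_of_exp_eq rfl, Complex.im_ofReal_mul, Complex.I_im,
      mul_one, ← sub_eq_add_neg]
  rw [two_mul, Real.Angle.coe_sub, Real.Angle.coe_add, coe_argDet hmem]
  nth_rewrite 1 [harg]
  rw [Real.Angle.coe_add]
  abel

theorem rotated_neg_sign_mul_pi_div_two (Z : Matrix k k ℂ) {G : Matrix k k ℂ}
    (hG : G.IsHermitian) {σ : SignType} (hσ : σ ≠ 0) :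
    rotated Z hG (-((σ : ℝ) * (Real.pi / 2))) = Z - (σ : ℝ) • Complex.I • G := by
  cases σ
  · exact absurd rfl hσ
  · simp [rotated_pi_div_two]
  · simp [rotated_neg_pi_div_two]

section RegularCrossing

variable {F : Filter ℝ} {σ : SignType} (hψ : HasDerivAt ψ ψ' t)
  (hG : (crossingMatrix (ψ t) ψ').IsHermitian)
  (hreg : (QuadraticMap.polarBilin (crossingForm (matrixPath ψ) t)).SeparatingLeft)
  (ht : (ψ t)ᴴ * ψ t = 1)

include hψ hreg ht

theorem rotated_one_sub_mem_accretive {θ : ℝ} (hθ : θ ∈ Icc (-(Real.pi / 2)) (Real.pi / 2)) :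
    rotated (1 - ψ t) hG θ ∈ accretive k ∧
      argDet (rotated (1 - ψ t) hG θ) =
        argDet (rotated (1 - ψ t) hG 0) + crossingSign (matrixPath ψ) t * (θ / 2) := by
  have hZG : (1 - ψ t) * crossingMatrix (ψ t) ψ' = 0 := by
    rw [sub_mul, one_mul, mul_crossingMatrix, sub_self]
  have hGZ : crossingMatrix (ψ t) ψ' * (1 - ψ t) = 0 := by
    rw [mul_sub, mul_one, crossingMatrix_mul ht, sub_self]
  have hker : ∀ v, (1 - ψ t) *ᵥ v = 0 → crossingMatrix (ψ t) ψ' *ᵥ v = 0 → v = 0 :=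
    fun v hZv hGv => eq_zero_of_crossingMatrix_mulVec_eq_zero hψ hG hreg
      (sub_eq_zero.mp (by simpa only [Matrix.sub_mulVec, Matrix.one_mulVec] using hZv)).symm hGv
  have hnonneg := re_dotProduct_one_sub_mulVec_nonneg ht
  refine ⟨rotated_mem_accretive hG hnonneg hZG hGZ hker hθ, ?_⟩
  rw [argDet_rotated hG hnonneg hZG hGZ hker hθ, crossingSign_matrixPath hψ hG]
  push_cast
  ring

theorem eventually_one_sub_mem_accretive (hF : F ≤ 𝓝[≠] t) (hσ0 : σ ≠ 0)
    (hσ : ∀ᶠ s in F, SignType.sign (s - t) = σ) (hunit : ∀ᶠ s in F, (ψ s)ᴴ * ψ s = 1) :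
    (∀ᶠ s in F, 1 - ψ s ∈ accretive k) ∧
      Tendsto (fun s => argDet (1 - ψ s)) F (𝓝 (argDet (rotated (1 - ψ t) hG 0) -
        σ * (Real.pi / 4 * crossingSign (matrixPath ψ) t))) := by
  set f := fun s => stretch (ψ t) (s - t) * (1 - ψ s) * stretch (ψ t) (s - t)
  set M := rotated (1 - ψ t) hG (-((σ : ℝ) * (Real.pi / 2)))
  have hangle : -((σ : ℝ) * (Real.pi / 2)) ∈ Icc (-(Real.pi / 2)) (Real.pi / 2) := by
    have := Real.pi_pos
    cases σ <;> constructor <;> simp <;> linarith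
  obtain ⟨hM, hargM⟩ := rotated_one_sub_mem_accretive hψ hG hreg ht hangle
  have hf : Tendsto f F (𝓝 M) := by
    simpa only [M, rotated_neg_sign_mul_pi_div_two _ hG hσ0] using
      tendsto_stretch_mul_one_sub_mul_stretch hψ ht hF hσ
  have hne : ∀ᶠ s in F, s ≠ t := hF self_mem_nhdsWithin
  have hacc : ∀ᶠ s in F, 1 - ψ s ∈ accretive k := by
    filter_upwards [hunit, ((Continuous.matrix_det continuous_id).tendsto M |>.comp
      hf).eventually_ne hM.2] with s hs hdet
    refine ⟨re_dotProduct_one_sub_mulVec_nonneg hs, fun h0 => hdet ?_⟩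
    simp only [Function.comp_apply, id, f, Matrix.det_mul, h0, mul_zero, zero_mul]
  have hfacc : Tendsto f F (𝓝[accretive k] M) := by
    refine tendsto_nhdsWithin_iff.mpr ⟨hf, ?_⟩
    filter_upwards [hacc, hne] with s hs hst
    exact mul_mul_mem_accretive (posDef_stretch _ (sub_ne_zero.mpr hst)) hs
  refine ⟨hacc, ?_⟩
  have hlim := (continuousOn_argDet M hM).tendsto.comp hfacc
  rw [hargM] at hlim
  convert hlim.congr' ?_ using 2
  · ring
  · filter_upwards [hacc, hne] with s hs hst
    exact argDet_mul_mul (posDef_stretch _ (sub_ne_zero.mpr hst)) hs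

end RegularCrossing

theorem eventually_nhdsWithin_diff_singleton_of_sign {p : ℝ → Prop} {S : Set ℝ}
    (h : ∀ σ : SignType, σ ≠ 0 → ∀ᶠ s in 𝓝[S \ {t} ∩ {s | SignType.sign (s - t) = σ}] t, p s) :
    ∀ᶠ s in 𝓝[S \ {t}] t, p s := by
  have hσ : ∀ σ : SignType, σ ≠ 0 →
      ∀ᶠ s in 𝓝[S \ {t}] t, SignType.sign (s - t) = σ → p s := fun σ hσ0 => by
    have := h σ hσ0
    rwa [nhdsWithin_inter', eventually_inf_principal] at this
  filter_upwards [hσ 1 (by decide), hσ (-1) (by decide), self_mem_nhdsWithin] with s hpos hneg hs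
  rcases lt_or_gt_of_ne hs.2 with hlt | hgt
  · exact hneg (sign_neg (sub_neg.mpr hlt))
  · exact hpos (sign_pos (sub_pos.mpr hgt))

theorem exists_hasJumps_argDet_one_sub {ψ' : ℝ → Matrix k k ℂ} {θ : ℝ → ℝ} (hl : 0 < l)
    (hψ : ∀ t ∈ Icc 0 l, HasDerivAt ψ (ψ' t) t) (hunit : ∀ t ∈ Icc 0 l, (ψ t)ᴴ * ψ t = 1)
    (hreg : RegularCrossings (matrixPath ψ) l) (hθ : ContinuousOn θ (Icc 0 l))
    (hdet : ∀ t ∈ Icc 0 l, (ψ t).det = Complex.exp (θ t * Complex.I)) :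
    ∃ b : ℝ → ℝ, (∀ t ∈ Icc 0 l, ψ t = 1 → b t = 0) ∧
      HasJumps (fun t => 2 * argDet (1 - ψ t) - θ t) (fun t => 2 * b t - θ t)
        (fun t => Real.pi / 2 * crossingSign (matrixPath ψ) t) 0 l := by
  have hherm : ∀ t : Icc 0 l, (crossingMatrix (ψ t) (ψ' t)).IsHermitian := fun t =>
    isHermitian_crossingMatrix (conjTranspose_mul_add_eq_zero_of_unitary (hψ t t.2) hunit t.2
      (uniqueDiffOn_Icc hl t t.2))
  refine ⟨fun t => if ht : t ∈ Icc 0 l then argDet (rotated (1 - ψ t) (hherm ⟨t, ht⟩) 0) else 0,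
    fun t ht hψt => ?_, fun t ht => eventually_nhdsWithin_diff_singleton_of_sign fun σ hσ0 => ?_⟩
  · have hker : ∀ v, crossingMatrix (ψ t) (ψ' t) *ᵥ v = 0 → v = 0 := fun v =>
      eq_zero_of_crossingMatrix_mulVec_eq_zero (hψ t ht) (hherm ⟨t, ht⟩) (hreg t ht)
        (by rw [hψt, Matrix.one_mulVec])
    simpa only [dif_pos ht, hψt, sub_self] using argDet_rotated_zero_zero (hherm ⟨t, ht⟩) hker
  · have hmem : ∀ᶠ s in 𝓝[Icc 0 l \ {t} ∩ {s | SignType.sign (s - t) = σ}] t,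
        s ∈ Icc 0 l ∧ SignType.sign (s - t) = σ :=
      eventually_mem_nhdsWithin.mono fun s hs => ⟨hs.1.1, hs.2⟩
    obtain ⟨hacc, hlim⟩ := eventually_one_sub_mem_accretive (hψ t ht) (hherm ⟨t, ht⟩) (hreg t ht)
      (hunit t ht) (nhdsWithin_mono t fun s hs => hs.1.2) hσ0 (hmem.mono fun s hs => hs.2)
      (hmem.mono fun s hs => hunit s hs.1)
    have hglim := (hlim.const_mul 2).sub
      ((hθ t ht).mono_left (nhdsWithin_mono t fun s hs => hs.1.1))
    filter_upwards [hmem, eventually_eq_of_coe_angle_eq hglim (by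
      filter_upwards [hacc, hmem] with s hs hsI
      exact coe_two_mul_argDet_one_sub_sub (hunit s hsI.1) hs (hdet s hsI.1))] with s hs hsv
    rw [hsv, hs.2, dif_pos ht]
    ring

theorem robbinSalamon_loop {ψ' : ℝ → Matrix k k ℂ} {θ : ℝ → ℝ} (hl : 0 < l)
    (hψ : ∀ t ∈ Icc 0 l, HasDerivAt ψ (ψ' t) t) (hunit : ∀ t ∈ Icc 0 l, (ψ t)ᴴ * ψ t = 1)
    (hψ0 : ψ 0 = 1) (hψl : ψ l = 1) (hreg : RegularCrossings (matrixPath ψ) l)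
    (hθ : ContinuousOn θ (Icc 0 l))
    (hdet : ∀ t ∈ Icc 0 l, (ψ t).det = Complex.exp (θ t * Complex.I)) :
    robbinSalamon (matrixPath ψ) l = (θ l - θ 0) / Real.pi := by
  obtain ⟨b, hb, hjumps⟩ := exists_hasJumps_argDet_one_sub hl hψ hunit hreg hθ hdet
  have hsub := hjumps.sub_eq hl
  rw [hb 0 (left_mem_Icc.mpr hl.le) hψ0, hb l (right_mem_Icc.mpr hl.le) hψl,
    ← mul_finsum_mem] at hsub
  rw [robbinSalamon, eq_div_iff Real.pi_pos.ne']
  linarith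

end UnitaryLoop

end MonodromyOrbit

namespace MonodromyOrbit

open Filter MvPolynomial Set

/-! ### Non-degenerate weighted homogeneous polynomials -/

section WeightedHomogeneous

theorem eval_pow_mul_of_isWeightedHomogeneous {R σ : Type*} [CommSemiring R]
    {φ : MvPolynomial σ R} {w : σ → ℕ} {n : ℕ} (hφ : IsWeightedHomogeneous w φ n) (s : R)
    (z : σ → R) : eval (fun i => s ^ w i * z i) φ = s ^ n * eval z φ := by
  rw [eval_eq, eval_eq, Finset.mul_sum]
  refine Finset.sum_congr rfl fun d hd => ?_
  have hweight : ∑ i ∈ d.support, w i * d i = n := by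
    rw [← hφ (mem_support_iff.mp hd), Finsupp.weight_apply, Finsupp.sum]
    simp only [smul_eq_mul, mul_comm]
  simp only [mul_pow, Finset.prod_mul_distrib, ← pow_mul, Finset.prod_pow_eq_pow_sum, hweight,
    mul_left_comm]

theorem eval_single_eq_zero {R σ : Type*} [CommSemiring R] [DecidableEq σ]
    {φ : MvPolynomial σ R} {i : σ} (hφ : ∀ a, coeff (Finsupp.single i a) φ = 0) (s : R) :
    eval (Pi.single i s) φ = 0 := by
  rw [eval_eq]
  refine Finset.sum_eq_zero fun d hd => ?_
  obtain ⟨j, hji, hj⟩ : ∃ j, j ≠ i ∧ d j ≠ 0 := by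
    by_contra! hd0
    refine mem_support_iff.mp hd ?_
    rw [show d = Finsupp.single i (d i) from Finsupp.ext fun j => ?_]
    · exact hφ _
    · rcases eq_or_ne j i with rfl | hji
      · rw [Finsupp.single_eq_same]
      · rw [hd0 j hji, Finsupp.single_eq_of_ne hji]
  rw [Finset.prod_eq_zero (Finsupp.mem_support_iff.mpr hj), mul_zero]
  rw [Pi.single_eq_of_ne hji, zero_pow hj]

theorem eval_aeval_single_add_single {R σ : Type*} [CommSemiring R] [DecidableEq σ]
    (φ : MvPolynomial σ R) (i j : σ) (x : R) :
    Polynomial.eval x (aeval (Pi.single i Polynomial.X + Pi.single j 1 : σ → Polynomial R) φ) =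
      eval (Pi.single i x + Pi.single j 1) φ := by
  have hcomp := MvPolynomial.comp_aeval_apply
    (Pi.single i Polynomial.X + Pi.single j 1 : σ → Polynomial R) (Polynomial.aeval x) φ
  rw [Polynomial.coe_aeval_eq_eval] at hcomp
  rw [hcomp, ← MvPolynomial.aeval_eq_eval]
  congr 2
  funext l
  rcases eq_or_ne l i with rfl | hi <;> rcases eq_or_ne l j with rfl | hj <;> simp [*]

theorem exists_ne_zero_eval_eq_zero {σ : Type*} [Nontrivial σ] {φ : MvPolynomial σ ℂ}
    {w : σ → ℕ} {n : ℕ} (hφ : IsWeightedHomogeneous w φ n) (hn : n ≠ 0) :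
    ∃ z : σ → ℂ, z ≠ 0 ∧ eval z φ = 0 := by
  classical
  obtain ⟨i, j, hij⟩ := exists_pair_ne σ
  set q := aeval (Pi.single i Polynomial.X + Pi.single j 1 : σ → Polynomial ℂ) φ
  have hq : ∀ x, q.eval x = eval (Pi.single i x + Pi.single j 1) φ :=
    eval_aeval_single_add_single φ i j
  by_cases hdeg : q.degree = 0
  swap
  · obtain ⟨x, hx⟩ := IsAlgClosed.exists_root q hdeg
    refine ⟨_, fun h0 => ?_, (hq x).symm.trans hx⟩
    simpa [hij.symm] using congrFun h0 j
  -- if `φ (x, 1)` is a constant `c`, then `φ (1, s ^ w j) = s ^ n * c` tends to `0` as `s → 0`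
  have hscale : ∀ s : ℂ, s ≠ 0 →
      eval (Pi.single i 1 + Pi.single j (s ^ w j)) φ = s ^ n * q.coeff 0 := by
    intro s hs
    have hqs := eval_pow_mul_of_isWeightedHomogeneous hφ s
      (Pi.single i (s ^ w i)⁻¹ + Pi.single j 1)
    rw [← hq, Polynomial.eq_C_of_degree_eq_zero hdeg, Polynomial.eval_C] at hqs
    rw [← hqs]
    congr 2
    funext l
    rcases eq_or_ne l i with rfl | hi
    · simp [hij, hs]
    · rcases eq_or_ne l j with rfl | hj <;> simp [*]
  have hcont : Continuous fun s : ℂ => eval (Pi.single i 1 + Pi.single j (s ^ w j)) φ :=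
    (MvPolynomial.continuous_eval φ).comp
      (continuous_const.add ((continuous_single j).comp (continuous_pow (w j))))
  have hlim : eval (Pi.single i 1 + Pi.single j (0 ^ w j)) φ = 0 ^ n * q.coeff 0 :=
    tendsto_nhds_unique_of_eventuallyEq (l := 𝓝[≠] (0 : ℂ))
    ((hcont.tendsto 0).mono_left nhdsWithin_le_nhds)
    (((continuous_pow n).mul continuous_const).tendsto 0 |>.mono_left nhdsWithin_le_nhds)
    (eventually_mem_nhdsWithin.mono hscale)
  refine ⟨_, fun h0 => ?_, hlim.trans (by rw [zero_pow hn, zero_mul])⟩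
  simpa [hij] using congrFun h0 i

end WeightedHomogeneous

section Nondegenerate

variable {m : ℕ} {W : MvPolynomial (Fin (m + 1)) ℂ} {w : Fin (m + 1) → ℕ} {h : ℕ}

theorem IsNondegenerate.exists_coeff_ne_zero (hW : IsNondegenerate W w h) (i : Fin (m + 1)) :
    ∃ (a : ℕ) (j : Fin (m + 1)), coeff (Finsupp.single i a + Finsupp.single j 1) W ≠ 0 ∧
      2 ≤ (Finsupp.single i a + Finsupp.single j 1 : Fin (m + 1) →₀ ℕ) i := by
  by_contra! hexp
  have hcoeff : ∀ j a, coeff (Finsupp.single i a + Finsupp.single j 1) W = 0 := fun j a => by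
    by_contra hne
    have hi := hexp a j hne
    have ha : a ≤ 1 := by
      simp only [Finsupp.add_apply, Finsupp.single_eq_same] at hi
      omega
    interval_cases a
    · have hcrit := hW.critical j
      rw [eval_zero, constantCoeff_eq, coeff_pderiv] at hcrit
      exact hne (by simpa using hcrit)
    · rcases eq_or_ne i j with rfl | hij
      · simp at hi
      · exact hne (hW.no_mixed_quadratic i j hij)
  have hcritical : ∀ (s : ℂ) j, eval (Pi.single i s) (pderiv j W) = 0 := fun s j =>
    eval_single_eq_zero (fun a => by rw [coeff_pderiv, hcoeff, zero_mul]) s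
  have haxis : Tendsto (fun s : ℂ => (Pi.single i s : Fin (m + 1) → ℂ)) (𝓝[≠] 0) (𝓝[≠] 0) :=
    tendsto_nhdsWithin_iff.mpr
      ⟨((continuous_single i).tendsto' 0 0 (Pi.single_zero i)).mono_left nhdsWithin_le_nhds,
        eventually_mem_nhdsWithin.mono fun s hs => by simpa using hs⟩
  obtain ⟨s, j, hj⟩ := (haxis.eventually hW.isolated).exists
  exact hj (hcritical s j)

theorem IsNondegenerate.weight_lt (hW : IsNondegenerate W w h) (i : Fin (m + 1)) : w i < h := by
  obtain ⟨a, j, hne, htwo⟩ := hW.exists_coeff_ne_zero i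
  have hweight := hW.homogeneous hne
  have hi := hW.w_pos i
  have hj := hW.w_pos j
  rw [map_add, Finsupp.weight_single, Finsupp.weight_single, smul_eq_mul, one_smul] at hweight
  rcases eq_or_ne i j with rfl | hij
  · simp only [Finsupp.add_apply, Finsupp.single_eq_same] at htwo
    nlinarith
  · rw [Finsupp.add_apply, Finsupp.single_eq_same, Finsupp.single_eq_of_ne hij] at htwo
    nlinarith

theorem IsNondegenerate.eval_pderiv_pow_mul (hW : IsNondegenerate W w h) (k : Fin (m + 1)) (s : ℂ)
    (z : Fin (m + 1) → ℂ) :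
    eval (fun i => s ^ w i * z i) (pderiv k W) * s ^ w k = s ^ h * eval z (pderiv k W) := by
  have hk : h - w k + w k = h := Nat.sub_add_cancel (hW.weight_lt k).le
  rw [eval_pow_mul_of_isWeightedHomogeneous (hW.homogeneous.pderiv hk), mul_right_comm, ← pow_add,
    hk]

theorem IsNondegenerate.exists_eval_pderiv_ne_zero (hW : IsNondegenerate W w h)
    {p : Fin (m + 1) → ℂ} (hp : p ≠ 0) : ∃ i, eval p (pderiv i W) ≠ 0 := by
  by_contra! hcritical
  obtain ⟨i, hi⟩ := Function.ne_iff.mp hp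
  have horbit : Tendsto (fun s : ℂ => (fun j => s ^ w j * p j : Fin (m + 1) → ℂ)) (𝓝[≠] 0)
      (𝓝[≠] 0) := by
    refine tendsto_nhdsWithin_iff.mpr ⟨(Continuous.tendsto' (by fun_prop) 0 0 ?_).mono_left
      nhdsWithin_le_nhds, eventually_mem_nhdsWithin.mono fun s hs h0 => ?_⟩
    · funext j
      rw [zero_pow (hW.w_pos j).ne', zero_mul, Pi.zero_apply]
    · exact mul_ne_zero (pow_ne_zero _ hs) hi (congrFun h0 i)
  obtain ⟨s, ⟨j, hj⟩, hs⟩ := ((horbit.eventually hW.isolated).and self_mem_nhdsWithin).exists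
  have hscale := hW.eval_pderiv_pow_mul j s p
  rw [hcritical, mul_zero] at hscale
  exact mul_ne_zero hj (pow_ne_zero _ hs) hscale

theorem IsNondegenerate.link_nonempty (hm : 1 ≤ m) (hW : IsNondegenerate W w h) {δ : ℝ}
    (hδ : 0 < δ) : (link W δ).Nonempty := by
  have : Nontrivial (Fin (m + 1)) := Fin.nontrivial_iff_two_le.mpr (by omega)
  obtain ⟨z, hz, hWz⟩ := exists_ne_zero_eval_eq_zero hW.homogeneous hW.h_pos.ne'
  obtain ⟨i, hi⟩ := Function.ne_iff.mp hz
  have hzi : 0 < ‖z i‖ := norm_pos_iff.mpr hi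
  set f : ℝ → ℝ := fun r => ∑ l, ‖(r : ℂ) ^ w l * z l‖ ^ 2
  have hf0 : f 0 = 0 := Finset.sum_eq_zero fun l _ => by simp [(hW.w_pos l).ne']
  set R : ℝ := max 1 (δ / ‖z i‖)
  have hR : 1 ≤ R := le_max_left _ _
  have hfR : δ ^ 2 ≤ f R := calc
    δ ^ 2 ≤ (R * ‖z i‖) ^ 2 := by
      gcongr
      exact (div_le_iff₀ hzi).mp (le_max_right _ _)
    _ ≤ (R ^ w i * ‖z i‖) ^ 2 := by
      gcongr
      exact le_self_pow₀ hR (hW.w_pos i).ne'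
    _ = ‖(R : ℂ) ^ w i * z i‖ ^ 2 := by
      rw [norm_mul, norm_pow, Complex.norm_real, Real.norm_of_nonneg (zero_le_one.trans hR)]
    _ ≤ f R := Finset.single_le_sum (f := fun l => ‖(R : ℂ) ^ w l * z l‖ ^ 2)
      (fun _ _ => by positivity) (Finset.mem_univ i)
  obtain ⟨r, -, hr⟩ := intermediate_value_Icc (zero_le_one.trans hR)
    (by fun_prop : Continuous f).continuousOn ⟨hf0.trans_le (by positivity), hfR⟩
  exact ⟨fun l => (r : ℂ) ^ w l * z l,
    by rw [eval_pow_mul_of_isWeightedHomogeneous hW.homogeneous, hWz, mul_zero], hr⟩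

theorem ne_zero_of_mem_link {δ : ℝ} (hδ : δ ≠ 0) {p : Fin (m + 1) → ℂ} (hp : p ∈ link W δ) :
    p ≠ 0 := by
  rintro rfl
  have hsphere := hp.2
  simp only [Pi.zero_apply, norm_zero, ne_eq, OfNat.ofNat_ne_zero, not_false_eq_true, zero_pow,
    Finset.sum_const_zero] at hsphere
  exact pow_ne_zero 2 hδ hsphere.symm

end Nondegenerate

section DiagonalSymmetry

variable {m : ℕ} {W : MvPolynomial (Fin (m + 1)) ℂ} {w : Fin (m + 1) → ℕ} {h : ℕ}

theorem prod_pow_eq_one_of_mem_diagonalSymmetry {g : Fin (m + 1) → ℂˣ}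
    (hg : g ∈ diagonalSymmetry W) {d : Fin (m + 1) →₀ ℕ} (hd : coeff d W ≠ 0) :
    ∏ i, g i ^ d i = 1 := by
  have hinv : ∑ e ∈ W.support, monomial e (coeff e W * ∏ i, (g i : ℂ) ^ e i) = W := by
    refine MvPolynomial.funext fun x => ?_
    rw [← hg x, map_sum, eval_eq' (g • x)]
    refine Finset.sum_congr rfl fun e _ => ?_
    rw [eval_monomial, Finsupp.prod_fintype _ _ (by simp), mul_assoc, ← Finset.prod_mul_distrib]
    simp only [← mul_pow]
    rfl
  have hcoeff := congrArg (coeff d) hinv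
  simp only [coeff_sum, coeff_monomial] at hcoeff
  rw [Finset.sum_ite_eq' W.support d, if_pos (mem_support_iff.mpr hd)] at hcoeff
  apply Units.ext
  push_cast
  exact mul_left_cancel₀ hd (hcoeff.trans (mul_one _).symm)

theorem det_smul_eq_zero_of_sum_smul_eq_zero {R M n : Type*} [CommRing R] [AddCommGroup M]
    [Module R M] [Fintype n] [DecidableEq n] (A : Matrix n n R) {x : n → M}
    (hx : ∀ i, ∑ r, A i r • x r = 0) (l : n) : A.det • x l = 0 := calc
  A.det • x l = ∑ r, (A.adjugate * A) l r • x r := by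
    simp [Matrix.adjugate_mul, Matrix.smul_apply, Matrix.one_apply, ite_smul]
  _ = ∑ i, A.adjugate l i • ∑ r, A i r • x r := by
    simp only [Matrix.mul_apply, Finset.sum_smul, Finset.smul_sum, smul_smul]
    exact Finset.sum_comm
  _ = 0 := Finset.sum_eq_zero fun i _ => by rw [hx, smul_zero]

theorem zpow_det_eq_one_of_prod_zpow_eq_one {G n : Type*} [CommGroup G] [Fintype n]
    [DecidableEq n] (A : Matrix n n ℤ) {g : n → G} (hg : ∀ i, ∏ r, g r ^ A i r = 1) (l : n) :
    g l ^ A.det = 1 :=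
  det_smul_eq_zero_of_sum_smul_eq_zero (M := Additive G) A hg l

theorem IsNondegenerate.exists_exponentMatrix (hW : IsNondegenerate W w h) :
    ∃ E : Fin (m + 1) → Fin (m + 1) →₀ ℕ, (∀ i, coeff (E i) W ≠ 0) ∧
      (Matrix.of fun i l => (E i l : ℤ)).det ≠ 0 := by
  choose a j hne htwo using hW.exists_coeff_ne_zero
  refine ⟨fun i => Finsupp.single i (a i) + Finsupp.single (j i) 1, hne, fun hdet => ?_⟩
  set E : Fin (m + 1) → Fin (m + 1) →₀ ℕ :=
    fun i => Finsupp.single i (a i) + Finsupp.single (j i) 1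
  have hdetR := RingHom.map_det (Int.castRingHom ℝ) (Matrix.of fun i l => (E i l : ℤ))
  rw [hdet, map_zero] at hdetR
  refine det_ne_zero_of_sum_row_lt_diag (fun i => ?_) hdetR.symm
  have hoff : ∑ l ∈ Finset.univ.erase i, E i l ≤ 1 := calc
    ∑ l ∈ Finset.univ.erase i, E i l = ∑ l ∈ Finset.univ.erase i, Finsupp.single (j i) 1 l :=
      Finset.sum_congr rfl fun l hl => by
        simp [E, Finsupp.single_eq_of_ne (Finset.ne_of_mem_erase hl)]
    _ ≤ ∑ l, Finsupp.single (j i) 1 l := Finset.sum_le_sum_of_subset (Finset.erase_subset _ _)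
    _ = 1 := by simp [Finsupp.single_apply]
  have hlt : ∑ l ∈ Finset.univ.erase i, (E i l : ℝ) < E i i := by
    exact_mod_cast hoff.trans_lt (htwo i)
  simpa using hlt

theorem IsNondegenerate.finite_diagonalSymmetry (hW : IsNondegenerate W w h) :
    Finite (diagonalSymmetry W) := by
  obtain ⟨E, hE, hdet⟩ := hW.exists_exponentMatrix
  set A := Matrix.of fun i l => (E i l : ℤ)
  have : NeZero A.det.natAbs := ⟨Int.natAbs_ne_zero.mpr hdet⟩
  have hroots : ∀ g ∈ diagonalSymmetry W, ∀ l, g l ∈ rootsOfUnity A.det.natAbs ℂ := by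
    intro g hg l
    rw [mem_rootsOfUnity, pow_natAbs_eq_one]
    exact zpow_det_eq_one_of_prod_zpow_eq_one A
      (fun i => by simpa [A] using prod_pow_eq_one_of_mem_diagonalSymmetry hg (hE i)) l
  have hfinite : (rootsOfUnity A.det.natAbs ℂ : Set ℂˣ).Finite :=
    @Set.toFinite _ _ (inferInstanceAs (Finite (rootsOfUnity A.det.natAbs ℂ)))
  exact ((Set.Finite.pi' fun _ => hfinite).subset hroots).to_subtype

end DiagonalSymmetry

end MonodromyOrbit

namespace MonodromyOrbit

open Matrix MvPolynomial

/-! ### Unitary frames and the volume form along the flow -/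

section Flow

variable {m : ℕ} {W : MvPolynomial (Fin (m + 1)) ℂ} {w : Fin (m + 1) → ℕ} {h : ℕ}

theorem flow_smul_apply (w : Fin (m + 1) → ℕ) (h : ℕ) (t : ℝ) (v : Fin (m + 1) → ℂ)
    (i : Fin (m + 1)) : (flow w h t • v) i = (flow w h t i : ℂ) * v i := rfl

theorem flow_zero (w : Fin (m + 1) → ℕ) (h : ℕ) : flow w h 0 = 1 :=
  funext fun i => Units.ext (by simp [flow])

theorem flow_eq_exp_pow (w : Fin (m + 1) → ℕ) (h : ℕ) (t : ℝ) (i : Fin (m + 1)) :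
    (flow w h t i : ℂ) = Complex.exp (2 * Real.pi * Complex.I * t / h) ^ w i := by
  rw [flow, Units.val_mk0, ← Complex.exp_nat_mul]
  congr 1
  ring

theorem prod_flow (w : Fin (m + 1) → ℕ) (h : ℕ) (t : ℝ) :
    ∏ i, (flow w h t i : ℂ) =
      Complex.exp (2 * Real.pi * Complex.I * ((∑ i, (w i : ℂ)) / h * t)) := by
  simp only [flow, Units.val_mk0]
  rw [← Complex.exp_sum, ← Finset.sum_mul, ← Finset.mul_sum, Finset.sum_div, mul_assoc]

theorem norm_exp_two_pi_mul_I_mul (x : ℝ) :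
    ‖Complex.exp (2 * Real.pi * Complex.I * x)‖ = 1 := by
  rw [Complex.norm_exp]
  simp

theorem norm_flow (w : Fin (m + 1) → ℕ) (h : ℕ) (t : ℝ) (i : Fin (m + 1)) :
    ‖(flow w h t i : ℂ)‖ = 1 := by
  rw [← norm_exp_two_pi_mul_I_mul (w i / h * t), flow, Units.val_mk0]
  push_cast
  rw [mul_assoc _ _ (t : ℂ)]

theorem conj_flow_mul_flow (w : Fin (m + 1) → ℕ) (h : ℕ) (t : ℝ) (i : Fin (m + 1)) :
    conj (flow w h t i : ℂ) * flow w h t i = 1 := by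
  rw [Complex.conj_mul', norm_flow, Complex.ofReal_one, one_pow]

theorem flow_smul_ne_zero (w : Fin (m + 1) → ℕ) (h : ℕ) (t : ℝ) {p : Fin (m + 1) → ℂ}
    (hp : p ≠ 0) : flow w h t • p ≠ 0 :=
  (smul_ne_zero_iff_ne _).mpr hp

theorem IsNondegenerate.eval_pderiv_flow (hW : IsNondegenerate W w h) (t : ℝ)
    (p : Fin (m + 1) → ℂ) (k : Fin (m + 1)) :
    eval (flow w h t • p) (pderiv k W) * flow w h t k =
      Complex.exp (2 * Real.pi * Complex.I * t) * eval p (pderiv k W) := by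
  have hexp : Complex.exp (2 * Real.pi * Complex.I * t / h) ^ h =
      Complex.exp (2 * Real.pi * Complex.I * t) := by
    rw [← Complex.exp_nat_mul, mul_div_cancel₀ _ (Nat.cast_ne_zero.mpr hW.h_pos.ne')]
  have hscale := hW.eval_pderiv_pow_mul k (Complex.exp (2 * Real.pi * Complex.I * t / h)) p
  simp only [← flow_eq_exp_pow, hexp] at hscale
  exact hscale

theorem isLinearMap_dW (W : MvPolynomial (Fin (m + 1)) ℂ) (z : Fin (m + 1) → ℂ) :
    IsLinearMap ℂ (dW W z) :=
  ⟨dotProduct_add _, fun c v => dotProduct_smul c _ v⟩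

theorem IsNondegenerate.dW_flow (hW : IsNondegenerate W w h) (t : ℝ) (p v : Fin (m + 1) → ℂ) :
    dW W (flow w h t • p) (flow w h t • v) =
      Complex.exp (2 * Real.pi * Complex.I * t) * dW W p v := by
  simp only [dW, flow_smul_apply, ← mul_assoc, hW.eval_pderiv_flow, Finset.mul_sum]

theorem dW_normalVector {z : Fin (m + 1) → ℂ} (hz : ∃ i, eval z (pderiv i W) ≠ 0) :
    dW W z (normalVector W z) = 1 := by
  obtain ⟨i, hi⟩ := hz
  have hpos : 0 < ∑ k, ‖eval z (pderiv k W)‖ ^ 2 :=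
    Finset.sum_pos' (fun k _ => sq_nonneg _)
      ⟨i, Finset.mem_univ i, pow_pos (norm_pos_iff.mpr hi) 2⟩
  simp only [dW, normalVector, mul_div_assoc', Complex.mul_conj']
  rw [← Finset.sum_div, div_eq_one_iff_eq (by exact_mod_cast hpos.ne')]
  push_cast
  rfl

theorem IsNondegenerate.normalVector_flow (hW : IsNondegenerate W w h) (t : ℝ)
    (p : Fin (m + 1) → ℂ) :
    normalVector W (flow w h t • p) =
      Complex.exp (-(2 * Real.pi * Complex.I * t)) • (flow w h t • normalVector W p) := by
  have hnorm : ∀ k, ‖eval (flow w h t • p) (pderiv k W)‖ = ‖eval p (pderiv k W)‖ := by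
    intro k
    simpa [norm_flow, norm_exp_two_pi_mul_I_mul] using congrArg norm (hW.eval_pderiv_flow t p k)
  have hexp : conj (Complex.exp (2 * Real.pi * Complex.I * t)) =
      Complex.exp (-(2 * Real.pi * Complex.I * t)) := by
    rw [← Complex.exp_conj]
    simp only [map_mul, map_ofNat, Complex.conj_ofReal, Complex.conj_I, mul_neg, neg_mul]
  funext k
  have hconj := congrArg conj (hW.eval_pderiv_flow t p k)
  rw [map_mul, map_mul, hexp] at hconj
  simp only [Pi.smul_apply, flow_smul_apply, normalVector, hnorm, smul_eq_mul, mul_div_assoc']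
  congr 1
  linear_combination (flow w h t k : ℂ) * hconj -
    conj (eval (flow w h t • p) (pderiv k W)) * conj_flow_mul_flow w h t k

variable {N : ℕ}

theorem isLinearMap_herm (w : Fin (m + 1) → ℕ) (u : Fin N → Fin (m + 1) → ℂ) :
    IsLinearMap ℂ (herm w u) where
  map_add v v' := by simp only [herm, Pi.add_apply, mul_add, Finset.sum_add_distrib]
  map_smul c v := by simp only [herm, Pi.smul_apply, smul_eq_mul, Finset.mul_sum, mul_left_comm c]

theorem conj_herm (w : Fin (m + 1) → ℕ) (u v : Fin N → Fin (m + 1) → ℂ) :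
    conj (herm w u v) = herm w v u := by
  simp only [herm, map_sum, map_mul, Complex.conj_ofReal, Complex.conj_conj, mul_comm (u _ _)]

theorem herm_smul_left (w : Fin (m + 1) → ℕ) (c : ℂ) (u v : Fin N → Fin (m + 1) → ℂ) :
    herm w (c • u) v = conj c * herm w u v := by
  rw [← conj_herm, (isLinearMap_herm w v).map_smul, smul_eq_mul, map_mul, conj_herm]

theorem herm_flow (w : Fin (m + 1) → ℕ) (h : ℕ) (t : ℝ) (u v : Fin N → Fin (m + 1) → ℂ) :
    herm w (fun c => flow w h t • u c) (fun c => flow w h t • v c) = herm w u v := by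
  simp only [herm, flow_smul_apply, map_mul]
  refine Finset.sum_congr rfl fun c _ => Finset.sum_congr rfl fun k _ => ?_
  rw [mul_mul_mul_comm, conj_flow_mul_flow, one_mul]

end Flow

section VolumeForm

variable {m N : ℕ} {W : MvPolynomial (Fin (m + 1)) ℂ} {w : Fin (m + 1) → ℕ} {h : ℕ}
  {z : Fin (m + 1) → ℂ}

/-- The vectors `F a` form a unitary frame of `(ker dW_z)^{⊕N}` with respect to `herm w`. -/
structure IsUnitaryFrame (W : MvPolynomial (Fin (m + 1)) ℂ) (w : Fin (m + 1) → ℕ)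
    (z : Fin (m + 1) → ℂ) (F : Fin N × Fin m → Fin N → Fin (m + 1) → ℂ) : Prop where
  tangent : ∀ a c, dW W z (F a c) = 0
  orthonormal : ∀ a b, herm w (F a) (F b) = if a = b then 1 else 0

theorem IsUnitaryFrame.flow {F : Fin N × Fin m → Fin N → Fin (m + 1) → ℂ}
    (hF : IsUnitaryFrame W w z F) (hW : IsNondegenerate W w h) (t : ℝ) :
    IsUnitaryFrame W w (flow w h t • z) (fun a c => MonodromyOrbit.flow w h t • F a c) where
  tangent a c := by rw [hW.dW_flow, hF.tangent, mul_zero]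
  orthonormal a b := by rw [herm_flow, hF.orthonormal]

theorem IsUnitaryFrame.smul {F : Fin N × Fin m → Fin N → Fin (m + 1) → ℂ}
    (hF : IsUnitaryFrame W w z F) {x : Fin N × Fin m → ℂ} (hx : ∀ a, ‖x a‖ = 1) :
    IsUnitaryFrame W w z (fun a => x a • F a) where
  tangent a c := by
    rw [Pi.smul_apply, (isLinearMap_dW W z).map_smul, hF.tangent, smul_zero]
  orthonormal a b := by
    rw [herm_smul_left, (isLinearMap_herm w _).map_smul, hF.orthonormal]
    split_ifs with hab
    · rw [hab, smul_eq_mul, mul_one, Complex.conj_mul', hx, Complex.ofReal_one, one_pow]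
    · rw [smul_zero, mul_zero]

/-- The frame `F` of `(ker dW_z)^{⊕N}`, completed by the normal vector in each of the `N` copies;
the determinant of this matrix is `volumeForm W z F`. -/
def completedFrame (W : MvPolynomial (Fin (m + 1)) ℂ) (z : Fin (m + 1) → ℂ)
    (F : Fin N × Fin m → Fin N → Fin (m + 1) → ℂ) :
    Matrix (Fin N × Fin (m + 1)) (Fin N × Fin (m + 1)) ℂ :=
  Matrix.of fun r s =>
    (Fin.cases (if r.1 = s.1 then normalVector W z r.2 else 0)
      (fun j => F (s.1, j) r.1 r.2) s.2 : ℂ)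

/-- The rows dual to `completedFrame`: the differentials `dW` of the `N` copies, and the Hermitian
products with the vectors of the frame. -/
def coframe (W : MvPolynomial (Fin (m + 1)) ℂ) (w : Fin (m + 1) → ℕ) (z : Fin (m + 1) → ℂ)
    (F : Fin N × Fin m → Fin N → Fin (m + 1) → ℂ) :
    Matrix (Fin N × Fin (m + 1)) (Fin N × Fin (m + 1)) ℂ :=
  Matrix.of fun r s =>
    (Fin.cases (if r.1 = s.1 then eval z (pderiv s.2 W) else 0)
      (fun j => ((Real.pi * (w s.2 : ℝ))⁻¹ : ℝ) * conj (F (r.1, j) s.1 s.2)) r.2 : ℂ)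

theorem volumeForm_flow (hW : IsNondegenerate W w h) (t : ℝ) (p : Fin (m + 1) → ℂ)
    (F : Fin N × Fin m → Fin N → Fin (m + 1) → ℂ) :
    volumeForm W (flow w h t • p) (fun a c => flow w h t • F a c) =
      Complex.exp (2 * Real.pi * Complex.I * (N * ((∑ i, (w i : ℂ)) / h - 1) * t)) *
        volumeForm W p F := by
  have hmul : completedFrame W (flow w h t • p) (fun a c => flow w h t • F a c) =
      diagonal (fun r : Fin N × Fin (m + 1) => (flow w h t r.2 : ℂ)) * completedFrame W p F *
        diagonal fun s : Fin N × Fin (m + 1) =>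
          (Fin.cases (Complex.exp (-(2 * Real.pi * Complex.I * t))) (fun _ => 1) s.2 : ℂ) := by
    ext ⟨a, i⟩ ⟨b, j⟩
    rw [mul_diagonal, diagonal_mul, completedFrame, completedFrame, of_apply, of_apply]
    refine Fin.cases ?_ (fun j => ?_) j
    · simp only [Fin.cases_zero, hW.normalVector_flow, Pi.smul_apply, flow_smul_apply, smul_eq_mul]
      split_ifs <;> ring
    · simp only [Fin.cases_succ, flow_smul_apply, mul_one]
  have hdet := congrArg det hmul
  rw [det_mul, det_mul, det_diagonal, det_diagonal, Fintype.prod_prod_type,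
    Fintype.prod_prod_type] at hdet
  simp only [prod_flow] at hdet
  simp only [Fin.prod_univ_succ, Fin.cases_zero, Fin.cases_succ, Finset.prod_const_one, mul_one,
    Finset.prod_const, Finset.card_univ, Fintype.card_fin, ← Complex.exp_nat_mul] at hdet
  refine hdet.trans ?_
  rw [mul_right_comm, ← Complex.exp_add]
  congr 2
  ring

theorem coframe_mulVec_zero (F : Fin N × Fin m → Fin N → Fin (m + 1) → ℂ)
    (x : Fin N × Fin (m + 1) → ℂ) (a : Fin N) :
    (coframe W w z F *ᵥ x) (a, 0) = dW W z (fun k => x (a, k)) := by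
  simp only [mulVec, dotProduct, coframe, of_apply, Fin.cases_zero, Fintype.sum_prod_type, dW,
    ite_mul, zero_mul]
  rw [Finset.sum_comm]
  simp only [Finset.sum_ite_eq, Finset.mem_univ, if_true]

theorem coframe_mulVec_succ (F : Fin N × Fin m → Fin N → Fin (m + 1) → ℂ)
    (x : Fin N × Fin (m + 1) → ℂ) (a : Fin N) (i : Fin m) :
    (coframe W w z F *ᵥ x) (a, i.succ) = herm w (F (a, i)) (fun c k => x (c, k)) := by
  simp only [mulVec, dotProduct, coframe, of_apply, Fin.cases_succ, Fintype.sum_prod_type, herm,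
    mul_assoc]

theorem det_eq_det_submatrix_succ {R ι : Type*} [CommRing R] [Fintype ι] [DecidableEq ι]
    {M : Matrix (ι × Fin (m + 1)) (ι × Fin (m + 1)) R}
    (hzero : ∀ a b, M (a, 0) (b, 0) = (1 : Matrix ι ι R) a b)
    (hsucc : ∀ a b j, M (a, 0) (b, Fin.succ j) = 0) :
    M.det = (M.submatrix (Prod.map id Fin.succ) (Prod.map id Fin.succ)).det := by
  let e : ι ⊕ ι × Fin m ≃ ι × Fin (m + 1) :=
    { toFun := Sum.elim (fun a => (a, 0)) (Prod.map id Fin.succ)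
      invFun := fun a => Fin.cases (Sum.inl a.1) (fun j => Sum.inr (a.1, j)) a.2
      left_inv := by rintro (a | a) <;> rfl
      right_inv := by
        rintro ⟨a, i⟩
        refine Fin.cases ?_ (fun j => ?_) i <;> rfl }
  have hblocks : M.submatrix e e = fromBlocks 1 0
      (M.submatrix (Prod.map id Fin.succ) fun a => (a, 0))
      (M.submatrix (Prod.map id Fin.succ) (Prod.map id Fin.succ)) := by
    ext (a | a) (b | b)
    · exact hzero a b
    · exact hsucc a b.1 b.2
    · rfl
    · rfl
  rw [← det_submatrix_equiv_self e, hblocks, det_fromBlocks_zero₁₂, det_one, one_mul]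

theorem det_coframe_mul_volumeForm (hz : ∃ i, eval z (pderiv i W) ≠ 0)
    (F : Fin N × Fin m → Fin N → Fin (m + 1) → ℂ)
    {G : Fin N × Fin m → Fin N → Fin (m + 1) → ℂ} (hG : ∀ a c, dW W z (G a c) = 0) :
    (coframe W w z F).det * volumeForm W z G = (of fun a b => herm w (F a) (G b)).det := by
  have hmul : ∀ r s, (coframe W w z F * completedFrame W z G) r s =
      (coframe W w z F *ᵥ fun q => completedFrame W z G q s) r := fun _ _ => rfl
  rw [show volumeForm W z G = (completedFrame W z G).det from rfl, ← det_mul,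
    det_eq_det_submatrix_succ (fun a b => ?_) (fun a b j => ?_)]
  · congr 1
    ext ⟨a, i⟩ ⟨b, j⟩
    exact (hmul _ _).trans (coframe_mulVec_succ F _ a i)
  · rw [hmul, coframe_mulVec_zero, one_apply]
    simp only [completedFrame, of_apply, Fin.cases_zero]
    split_ifs
    · exact dW_normalVector hz
    · exact (isLinearMap_dW W z).map_zero
  · rw [hmul, coframe_mulVec_zero]
    exact hG (b, j) a

theorem IsUnitaryFrame.det_coframe_mul_volumeForm_self (hz : ∃ i, eval z (pderiv i W) ≠ 0)
    {F : Fin N × Fin m → Fin N → Fin (m + 1) → ℂ} (hF : IsUnitaryFrame W w z F) :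
    (coframe W w z F).det * volumeForm W z F = 1 := by
  rw [det_coframe_mul_volumeForm hz F hF.tangent]
  simp only [hF.orthonormal]
  exact det_one

theorem IsUnitaryFrame.volumeForm_ne_zero (hz : ∃ i, eval z (pderiv i W) ≠ 0)
    {F : Fin N × Fin m → Fin N → Fin (m + 1) → ℂ} (hF : IsUnitaryFrame W w z F) :
    volumeForm W z F ≠ 0 :=
  right_ne_zero_of_mul_eq_one (hF.det_coframe_mul_volumeForm_self hz)

theorem IsUnitaryFrame.sum_herm_smul (hz : ∃ i, eval z (pderiv i W) ≠ 0)
    {F : Fin N × Fin m → Fin N → Fin (m + 1) → ℂ} (hF : IsUnitaryFrame W w z F)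
    {v : Fin N → Fin (m + 1) → ℂ} (hv : ∀ c, dW W z (v c) = 0) :
    ∑ a, herm w (F a) v • F a = v := by
  set x := ∑ a, herm w (F a) v • F a - v with hx
  have hdW : ∀ b, dW W z (x b) = 0 := by
    intro b
    simp only [hx, Pi.sub_apply, Finset.sum_apply, Pi.smul_apply]
    change (isLinearMap_dW W z).mk' _ _ = 0
    simp only [map_sub, map_sum, map_smul, IsLinearMap.mk'_apply, hF.tangent, hv, smul_zero,
      Finset.sum_const_zero, sub_zero]
  have hherm : ∀ b, herm w (F b) x = 0 := by
    intro b
    change (isLinearMap_herm w (F b)).mk' _ _ = 0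
    simp only [hx, map_sub, map_sum, map_smul, IsLinearMap.mk'_apply, hF.orthonormal, smul_eq_mul,
      mul_ite, mul_one, mul_zero, Finset.sum_ite_eq, Finset.mem_univ, if_true, sub_self]
  have hcoframe : coframe W w z F *ᵥ (fun s => x s.1 s.2) = 0 := by
    funext ⟨b, i⟩
    refine Fin.cases ?_ (fun j => ?_) i
    · exact (coframe_mulVec_zero F _ b).trans (hdW b)
    · exact (coframe_mulVec_succ F _ b j).trans (hherm (b, j))
  have hzero := eq_zero_of_mulVec_eq_zero
    (left_ne_zero_of_mul_eq_one (hF.det_coframe_mul_volumeForm_self hz)) hcoframe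
  exact sub_eq_zero.mp (funext fun c => funext fun k => congrFun hzero (c, k))

theorem IsUnitaryFrame.sum_conj_herm_mul_herm (hz : ∃ i, eval z (pderiv i W) ≠ 0)
    {F : Fin N × Fin m → Fin N → Fin (m + 1) → ℂ} (hF : IsUnitaryFrame W w z F)
    (u : Fin N → Fin (m + 1) → ℂ) {v : Fin N → Fin (m + 1) → ℂ} (hv : ∀ c, dW W z (v c) = 0) :
    ∑ a, conj (herm w (F a) u) * herm w (F a) v = herm w u v := by
  conv_rhs => rw [← hF.sum_herm_smul hz hv]
  change _ = (isLinearMap_herm w u).mk' _ _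
  simp only [map_sum, map_smul, IsLinearMap.mk'_apply, conj_herm, smul_eq_mul, mul_comm]

end VolumeForm

/-! ### The index in an adapted frame -/

section AdaptedFrame

variable {m N : ℕ} {W : MvPolynomial (Fin (m + 1)) ℂ} {w : Fin (m + 1) → ℕ} {h : ℕ}
  {p : Fin (m + 1) → ℂ} {F : ℝ → Fin N × Fin m → Fin N → Fin (m + 1) → ℂ}

theorem exp_eq_exp_im_mul_I {z : ℂ} (hz : ‖Complex.exp z‖ = 1) :
    Complex.exp z = Complex.exp (z.im * Complex.I) := by
  rw [Complex.norm_exp, Real.exp_eq_one_iff] at hz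
  conv_lhs => rw [← Complex.re_add_im z, hz, Complex.ofReal_zero, zero_add]

theorem norm_det_eq_one_of_conjTranspose_mul_self {ι : Type*} [Fintype ι] [DecidableEq ι]
    {A : Matrix ι ι ℂ} (hA : Aᴴ * A = 1) : ‖A.det‖ = 1 :=
  CStarRing.norm_of_mem_unitary (det_of_mem_unitary (mem_unitaryGroup_iff'.mpr hA))

theorem det_flowMatrix_mul_volumeForm (hW : IsNondegenerate W w h) (hp : p ≠ 0)
    (hF0 : IsUnitaryFrame W w p (F 0)) {t : ℝ}
    (hFt : IsUnitaryFrame W w (flow w h t • p) (F t)) :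
    (flowMatrix w h F t).det * volumeForm W (flow w h t • p) (F t) =
      Complex.exp (2 * Real.pi * Complex.I * (N * ((∑ i, (w i : ℂ)) / h - 1) * t)) *
        volumeForm W p (F 0) := by
  have hz := hW.exists_eval_pderiv_ne_zero (flow_smul_ne_zero w h t hp)
  have hself := hFt.det_coframe_mul_volumeForm_self hz
  have hflow := det_coframe_mul_volumeForm (w := w) hz (F t) (hF0.flow hW t).tangent
  rw [show flowMatrix w h F t = of fun a b => herm w (F t a) fun c => flow w h t • F 0 b c from rfl,
    ← hflow, ← volumeForm_flow hW, mul_right_comm, hself, one_mul]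

theorem conjTranspose_flowMatrix_mul_self (hW : IsNondegenerate W w h) (hp : p ≠ 0)
    (hF0 : IsUnitaryFrame W w p (F 0)) {t : ℝ}
    (hFt : IsUnitaryFrame W w (flow w h t • p) (F t)) :
    (flowMatrix w h F t)ᴴ * flowMatrix w h F t = 1 := by
  have hz := hW.exists_eval_pderiv_ne_zero (flow_smul_ne_zero w h t hp)
  have hflow := hF0.flow hW t
  ext a b
  rw [one_apply, ← hflow.orthonormal a b, ← hFt.sum_conj_herm_mul_herm hz _ (hflow.tangent b),
    mul_apply]
  rfl

theorem flowMatrix_eq_one {t : ℝ} (hFt : IsUnitaryFrame W w (flow w h t • p) (F t))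
    (hflow : ∀ a c, F t a c = flow w h t • F 0 a c) : flowMatrix w h F t = 1 := by
  ext a b
  rw [one_apply, ← hFt.orthonormal a b, flowMatrix, of_apply]
  simp only [← hflow]

theorem hasDerivAt_flowMatrix (hF : Differentiable ℝ F) (t : ℝ) :
    HasDerivAt (flowMatrix w h F) (of fun a b => deriv (fun s => flowMatrix w h F s a b) t) t := by
  refine hasDerivAt_pi.2 fun a => hasDerivAt_pi.2 fun b => DifferentiableAt.hasDerivAt ?_
  have hentry : ∀ c k, Differentiable ℝ fun s => F s a c k := fun c k =>
    differentiable_pi.1 (differentiable_pi.1 (differentiable_pi.1 hF a) c) k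
  have hofReal : Differentiable ℝ fun s : ℝ => (s : ℂ) := Complex.ofRealCLM.differentiable
  simp only [flowMatrix, of_apply, herm, flow_smul_apply, flow, Units.val_mk0]
  refine DifferentiableAt.fun_sum fun c _ => DifferentiableAt.fun_sum fun k _ => ?_
  exact ((hentry c k).star.mul (((hofReal.const_mul _).cexp).mul_const _)).const_mul _ t

theorem monodromyElement_inv_smul (hW : IsNondegenerate W w h) (v : Fin (m + 1) → ℂ) :
    (((monodromyElement hW)⁻¹ : diagonalSymmetry W) : Fin (m + 1) → ℂˣ) • v =
      (flow w h 1)⁻¹ • v := rfl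

theorem IsAdaptedFrame.isUnitaryFrame {g : diagonalSymmetry W} {l : ℝ}
    {F : ℝ → Fin (Nat.card (diagonalSymmetry W)) × Fin m →
      Fin (Nat.card (diagonalSymmetry W)) → Fin (m + 1) → ℂ}
    (hF : IsAdaptedFrame W w h g l p F) {t : ℝ} (ht : t ∈ Set.Icc 0 l) :
    IsUnitaryFrame W w (flow w h t • p) (F t) :=
  ⟨hF.tangent t ht, hF.orthonormal t ht⟩

theorem IsAdaptedFrame.exists_det_flowMatrix_eq_exp {g : diagonalSymmetry W} {l : ℝ} (hl : 0 ≤ l)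
    (hW : IsNondegenerate W w h) (hp : p ≠ 0)
    {F : ℝ → Fin (Nat.card (diagonalSymmetry W)) × Fin m →
      Fin (Nat.card (diagonalSymmetry W)) → Fin (m + 1) → ℂ}
    (hF : IsAdaptedFrame W w h g l p F) :
    ∃ θ : ℝ → ℝ, ContinuousOn θ (Set.Icc 0 l) ∧
      (∀ t ∈ Set.Icc 0 l, (flowMatrix w h F t).det = Complex.exp (θ t * Complex.I)) ∧
      θ l - θ 0 =
        2 * Real.pi * (Nat.card (diagonalSymmetry W) * ((∑ i, (w i : ℝ)) / h - 1) * l) := by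
  have hF0 : IsUnitaryFrame W w p (F 0) := by
    simpa only [flow_zero, one_smul] using hF.isUnitaryFrame ⟨le_rfl, hl⟩
  obtain ⟨L, hL, hexpL, hloop⟩ := hF.adapted
  have hexpL0 : Complex.exp (L 0) = volumeForm W p (F 0) := by
    simpa only [flow_zero, one_smul] using hexpL 0 ⟨le_rfl, hl⟩
  set d : ℝ := Nat.card (diagonalSymmetry W) * ((∑ i, (w i : ℝ)) / h - 1) with hd
  refine ⟨fun t => ((2 * Real.pi * (d * t) : ℝ) * Complex.I + L 0 - L t).im, ?_, ?_, ?_⟩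
  · exact Complex.continuous_im.comp_continuousOn (ContinuousOn.sub (by fun_prop) hL)
  · intro t ht
    have hdet : (flowMatrix w h F t).det =
        Complex.exp ((2 * Real.pi * (d * t) : ℝ) * Complex.I + L 0 - L t) := by
      have hvol := det_flowMatrix_mul_volumeForm hW hp hF0 (hF.isUnitaryFrame ht)
      rw [← hexpL t ht, ← hexpL0, ← Complex.exp_add, ← eq_div_iff (Complex.exp_ne_zero _),
        ← Complex.exp_sub] at hvol
      rw [hvol, hd]
      congr 3
      push_cast
      ring
    have hunit := conjTranspose_flowMatrix_mul_self hW hp hF0 (hF.isUnitaryFrame ht)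
    have hnorm := norm_det_eq_one_of_conjTranspose_mul_self hunit
    rw [hdet] at hnorm ⊢
    exact exp_eq_exp_im_mul_I hnorm
  · simp only [Complex.sub_im, Complex.add_im, Complex.im_ofReal_mul, Complex.I_im, hloop]
    ring

theorem IsAdaptedFrame.robbinSalamon_flowPath (hW : IsNondegenerate W w h) (hp : p ≠ 0)
    {F : ℝ → Fin (Nat.card (diagonalSymmetry W)) × Fin m →
      Fin (Nat.card (diagonalSymmetry W)) → Fin (m + 1) → ℂ}
    (hF : IsAdaptedFrame W w h (monodromyElement hW)⁻¹ 1 p F)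
    (hreg : RegularCrossings (flowPath w h F) 1) :
    robbinSalamon (flowPath w h F) 1 =
      2 * (Nat.card (diagonalSymmetry W) * ((∑ i, (w i : ℝ)) / h - 1)) := by
  have hfirst : (0 : ℝ) ∈ Set.Icc (0 : ℝ) 1 := ⟨le_rfl, zero_le_one⟩
  have hlast : (1 : ℝ) ∈ Set.Icc (0 : ℝ) 1 := ⟨zero_le_one, le_rfl⟩
  have hF0 : IsUnitaryFrame W w p (F 0) := by
    simpa only [flow_zero, one_smul] using hF.isUnitaryFrame hfirst
  have hinitial : flowMatrix w h F 0 = 1 :=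
    flowMatrix_eq_one (hF.isUnitaryFrame hfirst) fun a c => by rw [flow_zero, one_smul]
  have hfinal : flowMatrix w h F 1 = 1 := by
    refine flowMatrix_eq_one (hF.isUnitaryFrame hlast) fun a c => ?_
    rw [← hF.twist a c, monodromyElement_inv_smul, smul_inv_smul]
  obtain ⟨θ, hθ, hdet, hwinding⟩ := hF.exists_det_flowMatrix_eq_exp zero_le_one hW hp
  have hindex := robbinSalamon_loop one_pos
    (fun t _ => hasDerivAt_flowMatrix (hF.contDiff.differentiable one_ne_zero) t)
    (fun t ht => conjTranspose_flowMatrix_mul_self hW hp hF0 (hF.isUnitaryFrame ht))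
    hinitial hfinal hreg hθ hdet
  rw [show flowPath w h F = matrixPath (flowMatrix w h F) from rfl, hindex, hwinding, mul_one,
    mul_comm 2 Real.pi, mul_assoc, mul_div_cancel_left₀ _ Real.pi_ne_zero]

end AdaptedFrame

/-! ### Existence of adapted frames with regular crossings -/

section UnitaryFrame

variable {m : ℕ}

theorem exists_weighted_orthonormal_orthogonal {c : Fin (m + 1) → ℝ} (hc : ∀ k, 0 < c k)
    {u : Fin (m + 1) → ℂ} (hu : u ≠ 0) :
    ∃ e : Fin m → Fin (m + 1) → ℂ, (∀ j, u ⬝ᵥ e j = 0) ∧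
      ∀ i j, ∑ k, (c k : ℂ) * (conj (e i k) * e j k) = if i = j then 1 else 0 := by
  have hsqrt : ∀ k, (Real.sqrt (c k) : ℂ) ≠ 0 := fun k =>
    Complex.ofReal_ne_zero.mpr (Real.sqrt_pos.mpr (hc k)).ne'
  have hsq : ∀ k, (Real.sqrt (c k) : ℂ) * Real.sqrt (c k) = c k := fun k => by
    rw [← Complex.ofReal_mul, Real.mul_self_sqrt (hc k).le]
  let v : EuclideanSpace ℂ (Fin (m + 1)) := WithLp.toLp 2 fun k => conj (u k / Real.sqrt (c k))
  have hv : v ≠ 0 := by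
    obtain ⟨i, hi⟩ := Function.ne_iff.mp hu
    refine fun hzero => (map_ne_zero (starRingEnd ℂ)).mpr (div_ne_zero hi (hsqrt i)) ?_
    exact congrArg (fun x : EuclideanSpace ℂ (Fin (m + 1)) => x i) hzero
  have : Fact (Module.finrank ℂ (EuclideanSpace ℂ (Fin (m + 1))) = m + 1) :=
    ⟨finrank_euclideanSpace_fin⟩
  let b := OrthonormalBasis.fromOrthogonalSpanSingleton (𝕜 := ℂ) m hv
  refine ⟨fun j k => (b j : EuclideanSpace ℂ (Fin (m + 1))) k / Real.sqrt (c k),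
    fun j => ?_, fun i j => ?_⟩
  · have hperp := Submodule.mem_orthogonal_singleton_iff_inner_right.mp (b j).2
    rw [PiLp.inner_apply] at hperp
    rw [← hperp]
    refine Finset.sum_congr rfl fun k _ => ?_
    simp only [v, RCLike.inner_apply, Complex.conj_conj]
    ring
  · rw [← orthonormal_iff_ite.mp b.orthonormal i j, Submodule.coe_inner, PiLp.inner_apply]
    refine Finset.sum_congr rfl fun k _ => ?_
    rw [RCLike.inner_apply, map_div₀, Complex.conj_ofReal, div_mul_div_comm, hsq,
      mul_div_cancel₀ _ (Complex.ofReal_ne_zero.mpr (hc k).ne'), mul_comm]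

theorem exists_isUnitaryFrame {W : MvPolynomial (Fin (m + 1)) ℂ} {w : Fin (m + 1) → ℕ}
    (hw : ∀ i, 0 < w i) {z : Fin (m + 1) → ℂ} (hz : ∃ i, eval z (pderiv i W) ≠ 0) (N : ℕ) :
    ∃ E : Fin N × Fin m → Fin N → Fin (m + 1) → ℂ, IsUnitaryFrame W w z E := by
  obtain ⟨e, hker, horth⟩ := exists_weighted_orthonormal_orthogonal
    (c := fun k => (Real.pi * (w k : ℝ))⁻¹)
    (fun k => inv_pos.mpr (mul_pos Real.pi_pos (Nat.cast_pos.mpr (hw k))))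
    (u := fun k => eval z (pderiv k W)) (Function.ne_iff.mpr hz)
  refine ⟨fun a => Pi.single a.1 (e a.2), ⟨fun a c => ?_, ?_⟩⟩
  · obtain rfl | hc := eq_or_ne c a.1
    · rw [Pi.single_eq_same]
      exact hker a.2
    · rw [Pi.single_eq_of_ne hc]
      exact (isLinearMap_dW W z).map_zero
  · rintro ⟨a, i⟩ ⟨b, j⟩
    rw [herm, Finset.sum_eq_single a (fun c _ hc => ?_) (fun ha => absurd (Finset.mem_univ a) ha)]
    · obtain rfl | hab := eq_or_ne a b
      · simpa only [Pi.single_eq_same, Prod.mk.injEq, true_and] using horth i j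
      · simp only [Pi.single_eq_of_ne hab, Pi.zero_apply, mul_zero, Finset.sum_const_zero,
          Prod.mk.injEq, hab, false_and, if_false]
    · simp only [Pi.single_eq_of_ne hc, Pi.zero_apply, map_zero, zero_mul, mul_zero,
        Finset.sum_const_zero]

end UnitaryFrame

section RotationNumbers

variable {m : ℕ} {W : MvPolynomial (Fin (m + 1)) ℂ} {w : Fin (m + 1) → ℕ} {h : ℕ}

theorem exists_nonzero_int_sum_eq {ι : Type*} [Fintype ι] [Nontrivial ι] (d : ℤ) :
    ∃ κ : ι → ℤ, (∀ i, κ i ≠ 0) ∧ ∑ i, κ i = d := by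
  classical
  obtain ⟨x⟩ : Nonempty ι := inferInstance
  have hcard : (1 : ℤ) < Fintype.card ι := by exact_mod_cast Fintype.one_lt_card
  obtain ⟨k, hk, hkx⟩ : ∃ k : ℤ, k ≠ 0 ∧ k + (d - Fintype.card ι * k) ≠ 0 := by
    by_cases hone : 1 + (d - Fintype.card ι) = 0
    · exact ⟨2, two_ne_zero, by omega⟩
    · exact ⟨1, one_ne_zero, by rwa [mul_one]⟩
  refine ⟨fun i => k + (Pi.single x (d - Fintype.card ι * k) : ι → ℤ) i, fun i => ?_, ?_⟩
  · obtain rfl | hix := eq_or_ne i x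
    · simpa only [Pi.single_eq_same] using hkx
    · simpa only [Pi.single_eq_of_ne hix, add_zero] using hk
  · rw [Finset.sum_add_distrib, Finset.sum_const, Finset.card_univ, nsmul_eq_mul,
      Finset.sum_pi_single', if_pos (Finset.mem_univ x), add_sub_cancel]

theorem monodromyElement_pow_apply (hW : IsNondegenerate W w h) (k : ℕ) (i : Fin (m + 1)) :
    (((monodromyElement hW ^ k : diagonalSymmetry W) : Fin (m + 1) → ℂˣ) i : ℂ) =
      Complex.exp (2 * Real.pi * Complex.I / h) ^ (k * w i) := by
  have hone := flow_eq_exp_pow w h 1 i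
  rw [Complex.ofReal_one, mul_one] at hone
  rw [mul_comm k, pow_mul, ← hone]
  rfl

theorem IsNondegenerate.dvd_mul_weight_of_monodromyElement_pow_eq_one
    (hW : IsNondegenerate W w h) {k : ℕ} (hk : monodromyElement hW ^ k = 1) (i : Fin (m + 1)) :
    h ∣ k * w i := by
  refine (Complex.isPrimitiveRoot_exp h hW.h_pos.ne').dvd_of_pow_eq_one _ ?_
  rw [← monodromyElement_pow_apply hW, hk]
  rfl

theorem IsNondegenerate.nontrivial_diagonalSymmetry (hW : IsNondegenerate W w h) :
    Nontrivial (diagonalSymmetry W) := by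
  refine ⟨monodromyElement hW, 1, fun hone => (hW.weight_lt 0).not_ge ?_⟩
  have hdvd := hW.dvd_mul_weight_of_monodromyElement_pow_eq_one ((pow_one _).trans hone) 0
  rw [one_mul] at hdvd
  exact Nat.le_of_dvd (hW.w_pos 0) hdvd

theorem IsNondegenerate.exists_int_eq_card_mul (hW : IsNondegenerate W w h) :
    ∃ d : ℤ, (d : ℂ) = Nat.card (diagonalSymmetry W) * ((∑ i, (w i : ℂ)) / h - 1) := by
  obtain ⟨k, hk⟩ : h ∣ Nat.card (diagonalSymmetry W) * ∑ i, w i := by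
    rw [Finset.mul_sum]
    exact Finset.dvd_sum fun i _ =>
      hW.dvd_mul_weight_of_monodromyElement_pow_eq_one pow_card_eq_one' i
  have hk' : (Nat.card (diagonalSymmetry W) : ℂ) * ∑ i, (w i : ℂ) = h * k := by exact_mod_cast hk
  refine ⟨k - Nat.card (diagonalSymmetry W), ?_⟩
  rw [mul_sub, mul_div_assoc', hk', mul_div_cancel_left₀ _ (Nat.cast_ne_zero.mpr hW.h_pos.ne')]
  push_cast
  ring

end RotationNumbers

section DiagonalFlow

variable {ι : Type*} [Fintype ι] [DecidableEq ι] {α : ι → ℝ}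

/-- The unitary one-parameter group rotating the `a`-th coordinate with angular speed `α a`. -/
def diagonalFlow (α : ι → ℝ) (t : ℝ) : Matrix ι ι ℂ :=
  diagonal fun a => Complex.exp ((α a * t : ℝ) * Complex.I)

theorem det_diagonalFlow (α : ι → ℝ) (t : ℝ) :
    (diagonalFlow α t).det = Complex.exp (((∑ a, α a) * t : ℝ) * Complex.I) := by
  rw [diagonalFlow, det_diagonal, ← Complex.exp_sum, ← Finset.sum_mul, ← Complex.ofReal_sum,
    ← Finset.sum_mul]

theorem hasDerivAt_diagonalFlow (α : ι → ℝ) (t : ℝ) :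
    HasDerivAt (diagonalFlow α)
      (diagonal (fun a => (α a : ℂ) * Complex.I) * diagonalFlow α t) t := by
  refine hasDerivAt_pi.2 fun a => hasDerivAt_pi.2 fun b => ?_
  rw [diagonalFlow, diagonal_mul]
  obtain rfl | hab := eq_or_ne a b
  · simp only [diagonalFlow, diagonal_apply_eq]
    have hangle :
        HasDerivAt (fun s : ℝ => ((α a * s : ℝ) : ℂ) * Complex.I) (α a * Complex.I) t := by
      simpa using (((hasDerivAt_id t).const_mul (α a)).ofReal_comp).mul_const Complex.I
    rw [mul_comm]
    exact hangle.cexp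
  · simp only [diagonalFlow, diagonal_apply_ne _ hab, mul_zero]
    exact hasDerivAt_const t 0

theorem mem_crossingSpace_diagonalFlow {t : ℝ} {v : ι → ℂ} :
    v ∈ crossingSpace (matrixPath (diagonalFlow α)) t ↔
      ∀ a, Complex.exp ((α a * t : ℝ) * Complex.I) * v a = v a := by
  simp only [mem_crossingSpace_matrixPath, diagonalFlow, funext_iff, mulVec_diagonal]

theorem crossingForm_diagonalFlow_apply {t : ℝ}
    (v : crossingSpace (matrixPath (diagonalFlow α)) t) :
    crossingForm (matrixPath (diagonalFlow α)) t v = ∑ a, α a * ‖(v : ι → ℂ) a‖ ^ 2 := by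
  rw [crossingForm_matrixPath_apply (hasDerivAt_diagonalFlow α t), ← mulVec_mulVec,
    mem_crossingSpace_matrixPath.mp v.2, dotProduct, Complex.im_sum]
  refine Finset.sum_congr rfl fun a _ => ?_
  rw [mulVec_diagonal, Pi.star_apply, Complex.star_def, mul_left_comm, Complex.conj_mul',
    mul_right_comm, ← Complex.ofReal_pow, ← Complex.ofReal_mul, Complex.im_ofReal_mul, Complex.I_im,
    mul_one]

theorem regularCrossings_diagonalFlow (hα : ∀ a, α a ≠ 0) (l : ℝ) :
    RegularCrossings (matrixPath (diagonalFlow α)) l := by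
  intro t _ v hv
  have hmem : (fun a => (α a : ℂ) * (v : ι → ℂ) a) ∈
      crossingSpace (matrixPath (diagonalFlow α)) t :=
    mem_crossingSpace_diagonalFlow.mpr fun a => by
      rw [mul_left_comm, mem_crossingSpace_diagonalFlow.mp v.2]
  have hpolar := hv ⟨_, hmem⟩
  simp only [QuadraticMap.polarBilin_apply_apply, QuadraticMap.polar,
    crossingForm_diagonalFlow_apply, ← Finset.sum_sub_distrib] at hpolar
  have hsum : ∑ a, 2 * (α a * ‖(v : ι → ℂ) a‖) ^ 2 = 0 := by
    rw [← hpolar]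
    refine Finset.sum_congr rfl fun a _ => ?_
    rw [Submodule.coe_add, Pi.add_apply, ← one_add_mul, norm_mul, norm_mul, Complex.norm_real,
      ← Complex.ofReal_one, ← Complex.ofReal_add, Complex.norm_real, mul_pow, mul_pow,
      mul_pow, Real.norm_eq_abs, Real.norm_eq_abs, sq_abs, sq_abs]
    ring
  rw [Finset.sum_eq_zero_iff_of_nonneg fun a _ => by positivity] at hsum
  refine Subtype.ext (funext fun a => norm_eq_zero.mp ?_)
  have hsq := hsum a (Finset.mem_univ a)
  exact (mul_eq_zero.mp (pow_eq_zero_iff two_ne_zero |>.mp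
    ((mul_eq_zero.mp hsq).resolve_left two_ne_zero))).resolve_left (hα a)

end DiagonalFlow

section TwistedFrame

variable {m N : ℕ} {W : MvPolynomial (Fin (m + 1)) ℂ} {w : Fin (m + 1) → ℕ} {h : ℕ}
  {p : Fin (m + 1) → ℂ} {E : Fin N × Fin m → Fin N → Fin (m + 1) → ℂ} {κ : Fin N × Fin m → ℤ}

/-- The image of the frame `E` under the flow, with the `a`-th vector rotated `κ a` times backwards
per unit of time; the linearized flow in this frame is a diagonal rotation. -/
def twistedFrame (w : Fin (m + 1) → ℕ) (h : ℕ) (E : Fin N × Fin m → Fin N → Fin (m + 1) → ℂ)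
    (κ : Fin N × Fin m → ℤ) (t : ℝ) (a : Fin N × Fin m) : Fin N → Fin (m + 1) → ℂ :=
  Complex.exp ((-(2 * Real.pi * κ a * t) : ℝ) * Complex.I) • fun c => flow w h t • E a c

theorem twistedFrame_zero : twistedFrame w h E κ 0 = E := by
  funext a
  simp only [twistedFrame, mul_zero, neg_zero, Complex.ofReal_zero, zero_mul, Complex.exp_zero,
    flow_zero, one_smul]

theorem twistedFrame_one (a : Fin N × Fin m) (c : Fin N) :
    twistedFrame w h E κ 1 a c = flow w h 1 • E a c := by
  have hexp : Complex.exp ((-(2 * Real.pi * κ a * 1) : ℝ) * Complex.I) = 1 := by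
    rw [Complex.exp_eq_one_iff]
    exact ⟨-κ a, by push_cast; ring⟩
  rw [twistedFrame, hexp, one_smul]

theorem contDiff_twistedFrame : ContDiff ℝ 1 (twistedFrame w h E κ) := by
  refine contDiff_pi.mpr fun a => contDiff_pi.mpr fun c => contDiff_pi.mpr fun k => ?_
  simp only [twistedFrame, Pi.smul_apply, smul_eq_mul, flow_smul_apply, flow, Units.val_mk0]
  have hofReal : ContDiff ℝ 1 fun t : ℝ => (t : ℂ) := Complex.ofRealCLM.contDiff
  have hangle : ContDiff ℝ 1 fun t : ℝ => -(2 * Real.pi * κ a * t) := by fun_prop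
  exact ((hofReal.comp hangle).mul contDiff_const).cexp.mul
    ((contDiff_const.mul hofReal).cexp.mul contDiff_const)

theorem IsUnitaryFrame.twistedFrame (hE : IsUnitaryFrame W w p E) (hW : IsNondegenerate W w h)
    (t : ℝ) : IsUnitaryFrame W w (MonodromyOrbit.flow w h t • p)
      (MonodromyOrbit.twistedFrame w h E κ t) :=
  (hE.flow hW t).smul fun _ => Complex.norm_exp_ofReal_mul_I _

theorem IsUnitaryFrame.flowMatrix_twistedFrame (hE : IsUnitaryFrame W w p E) :
    flowMatrix w h (MonodromyOrbit.twistedFrame w h E κ) =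
      diagonalFlow fun a => 2 * Real.pi * κ a := by
  funext t
  ext a b
  rw [flowMatrix, of_apply, twistedFrame_zero, MonodromyOrbit.twistedFrame, herm_smul_left,
    herm_flow, hE.orthonormal, diagonalFlow, diagonal_apply, mul_ite, mul_one, mul_zero,
    ← Complex.exp_conj, map_mul, Complex.conj_ofReal, Complex.conj_I, Complex.ofReal_neg,
    neg_mul_neg]

theorem IsUnitaryFrame.volumeForm_twistedFrame (hE : IsUnitaryFrame W w p E)
    (hW : IsNondegenerate W w h) (hp : p ≠ 0)
    (hκ : ((∑ a, κ a : ℤ) : ℂ) = N * ((∑ i, (w i : ℂ)) / h - 1)) (t : ℝ) :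
    volumeForm W (MonodromyOrbit.flow w h t • p) (MonodromyOrbit.twistedFrame w h E κ t) =
      volumeForm W p E := by
  have hE0 : IsUnitaryFrame W w p (MonodromyOrbit.twistedFrame w h E κ 0) := by
    rwa [twistedFrame_zero]
  have hvol := det_flowMatrix_mul_volumeForm hW hp hE0 (hE.twistedFrame (κ := κ) hW t)
  rw [hE.flowMatrix_twistedFrame, det_diagonalFlow, twistedFrame_zero, ← hκ,
    ← Finset.mul_sum] at hvol
  refine mul_left_cancel₀ (Complex.exp_ne_zero _) (hvol.trans ?_)
  congr 2
  push_cast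
  ring

theorem exists_isAdaptedFrame_regularCrossings (hm : 1 ≤ m) (hW : IsNondegenerate W w h)
    (hp : p ≠ 0) :
    ∃ F, IsAdaptedFrame W w h (monodromyElement hW)⁻¹ 1 p F ∧
      RegularCrossings (flowPath w h F) 1 := by
  have hz := hW.exists_eval_pderiv_ne_zero hp
  have := hW.finite_diagonalSymmetry
  have := hW.nontrivial_diagonalSymmetry
  have : Nontrivial (Fin (Nat.card (diagonalSymmetry W))) :=
    Fin.nontrivial_iff_two_le.mpr Finite.one_lt_card
  have : Nonempty (Fin m) := ⟨⟨0, hm⟩⟩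
  obtain ⟨d, hd⟩ := hW.exists_int_eq_card_mul
  obtain ⟨κ, hκ, hsum⟩ :=
    exists_nonzero_int_sum_eq (ι := Fin (Nat.card (diagonalSymmetry W)) × Fin m) d
  obtain ⟨E, hE⟩ := exists_isUnitaryFrame hW.w_pos hz (Nat.card (diagonalSymmetry W))
  have hframe := fun t => hE.twistedFrame (κ := κ) hW t
  have hvol := hE.volumeForm_twistedFrame hW hp (by rw [hsum, hd])
  refine ⟨twistedFrame w h E κ, ⟨contDiff_twistedFrame, fun t _ => (hframe t).tangent,
    fun t _ => (hframe t).orthonormal, fun a c => ?_, ?_⟩, ?_⟩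
  · rw [monodromyElement_inv_smul, twistedFrame_one, twistedFrame_zero, inv_smul_smul]
  · exact ⟨fun _ => Complex.log (volumeForm W p E), continuousOn_const, fun t _ => by
      rw [hvol, Complex.exp_log (hE.volumeForm_ne_zero hz)], rfl⟩
  · change RegularCrossings (matrixPath (flowMatrix w h (twistedFrame w h E κ))) 1
    rw [hE.flowMatrix_twistedFrame]
    exact regularCrossings_diagonalFlow (fun a => mul_ne_zero Real.two_pi_pos.ne'
      (Int.cast_ne_zero.mpr (hκ a))) 1

end TwistedFrame

/-! ### The space of principal orbits -/

section PrincipalOrbits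

variable {m : ℕ} {W : MvPolynomial (Fin (m + 1)) ℂ} {w : Fin (m + 1) → ℕ} {h : ℕ}
  {p : Fin (m + 1) → ℂ} {δ : ℝ}

theorem monodromyElement_inv_smul_flow_smul (hW : IsNondegenerate W w h) (v : Fin (m + 1) → ℂ) :
    (((monodromyElement hW)⁻¹ : diagonalSymmetry W) : Fin (m + 1) → ℂˣ) • (flow w h 1 • v) = v := by
  rw [monodromyElement_inv_smul, inv_smul_smul]

theorem twistedOrbits_monodromyElement_inv (hW : IsNondegenerate W w h) (δ : ℝ) :
    twistedOrbits W w h δ (monodromyElement hW)⁻¹ 1 = link W δ :=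
  Set.ext fun p => and_iff_left (monodromyElement_inv_smul_flow_smul hW p)

theorem indexValues_monodromyElement_inv (hm : 1 ≤ m) (hW : IsNondegenerate W w h) (hδ : 0 < δ) :
    indexValues W w h δ (monodromyElement hW)⁻¹ 1 = {2 * ((∑ i, (w i : ℝ)) - h) / h} := by
  have := hW.finite_diagonalSymmetry
  have hN : (Nat.card (diagonalSymmetry W) : ℝ) ≠ 0 := Nat.cast_ne_zero.mpr Nat.card_pos.ne'
  have hh : (h : ℝ) ≠ 0 := Nat.cast_ne_zero.mpr hW.h_pos.ne'
  have hvalue : ∀ {p F}, p ∈ link W δ → IsAdaptedFrame W w h (monodromyElement hW)⁻¹ 1 p F →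
      RegularCrossings (flowPath w h F) 1 →
      robbinSalamon (flowPath w h F) 1 / (Nat.card (diagonalSymmetry W) : ℝ) =
        2 * ((∑ i, (w i : ℝ)) - h) / h := by
    intro p F hp hF hreg
    rw [hF.robbinSalamon_flowPath hW (ne_zero_of_mem_link hδ.ne' hp) hreg, mul_left_comm,
      mul_div_cancel_left₀ _ hN, div_sub_one hh, mul_div_assoc]
  refine Set.eq_singleton_iff_unique_mem.mpr ⟨?_, ?_⟩
  · obtain ⟨p, hp⟩ := hW.link_nonempty hm hδ
    obtain ⟨F, hF, hreg⟩ :=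
      exists_isAdaptedFrame_regularCrossings hm hW (ne_zero_of_mem_link hδ.ne' hp)
    exact ⟨p, (twistedOrbits_monodromyElement_inv hW δ).ge hp, F, hF, hreg,
      (hvalue hp hF hreg).symm⟩
  · rintro μ ⟨p, hp, F, hF, hreg, rfl⟩
    exact hvalue hp.1 hF hreg

theorem componentIndex_eq_of_indexValues_eq_singleton {g : diagonalSymmetry W} {l μ : ℝ}
    (hμ : indexValues W w h δ g l = {μ}) : componentIndex W w h δ g l = μ := by
  have hspec := Classical.epsilon_spec (p := fun x : ℝ => indexValues W w h δ g l = {x}) ⟨μ, hμ⟩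
  exact Set.singleton_injective (hspec.symm.trans hμ)

theorem IsNondegenerate.dW_weight_mul (hW : IsNondegenerate W w h) (p : Fin (m + 1) → ℂ) :
    dW W p (fun i => w i * p i) = h * eval p W := by
  have heuler := congrArg (eval p) hW.homogeneous.sum_weight_X_mul_pderiv
  simp only [map_sum, map_mul, eval_X, nsmul_eq_mul, map_natCast] at heuler
  rw [← heuler, dW]
  exact Finset.sum_congr rfl fun i _ => by ring

theorem dotProduct_star_weight_mul_re_pos (hw : ∀ i, 0 < w i) (hp : p ≠ 0) :
    0 < (star p ⬝ᵥ fun i => w i * p i).re := by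
  have hsum : star p ⬝ᵥ (fun i => w i * p i) = ((∑ i, (w i : ℝ) * ‖p i‖ ^ 2 : ℝ) : ℂ) := by
    rw [Complex.ofReal_sum]
    refine Finset.sum_congr rfl fun i _ => ?_
    rw [Pi.star_apply, Complex.star_def, mul_left_comm, Complex.conj_mul', Complex.ofReal_mul,
      Complex.ofReal_pow, Complex.ofReal_natCast]
  rw [hsum, Complex.ofReal_re]
  obtain ⟨i, hi⟩ := Function.ne_iff.mp hp
  exact Finset.sum_pos' (fun k _ => by positivity)
    ⟨i, Finset.mem_univ i, mul_pos (Nat.cast_pos.mpr (hw i)) (pow_pos (norm_pos_iff.mpr hi) 2)⟩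

/-- The differential at `p` of `(W, ‖·‖² / 2)`, the pair of functions that cuts out the link. -/
def linkDifferential (W : MvPolynomial (Fin (m + 1)) ℂ) (p : Fin (m + 1) → ℂ) :
    (Fin (m + 1) → ℂ) →ₗ[ℝ] ℂ × ℝ :=
  (((isLinearMap_dW W p).mk' (dW W p)).restrictScalars ℝ).prod
    (Complex.reLm ∘ₗ (dotProductBilin ℂ ℂ (star p)).restrictScalars ℝ)

theorem linkDifferential_apply (v : Fin (m + 1) → ℂ) :
    linkDifferential W p v = (dW W p v, (star p ⬝ᵥ v).re) := rfl

/-- The link is transverse to the vector field `(w_i z_i)`, which is tangent to `W⁻¹(0)`. -/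
theorem linkDifferential_surjective (hW : IsNondegenerate W w h) (hp : p ≠ 0)
    (hWp : eval p W = 0) : Function.Surjective (linkDifferential W p) := by
  have hpos := dotProduct_star_weight_mul_re_pos hW.w_pos hp
  set e : Fin (m + 1) → ℂ := fun i => w i * p i with he
  have hradial : linkDifferential W p e = (0, (star p ⬝ᵥ e).re) := by
    rw [linkDifferential_apply, he, hW.dW_weight_mul, hWp, mul_zero]
  rintro ⟨a, b⟩
  set u : Fin (m + 1) → ℂ := a • normalVector W p
  have hnormal : linkDifferential W p u = (a, (star p ⬝ᵥ u).re) := by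
    rw [linkDifferential_apply, (isLinearMap_dW W p).map_smul,
      dW_normalVector (hW.exists_eval_pderiv_ne_zero hp), smul_eq_mul, mul_one]
  refine ⟨u + ((b - (star p ⬝ᵥ u).re) / (star p ⬝ᵥ e).re) • e, ?_⟩
  rw [map_add, hnormal, map_smul, hradial, Prod.smul_mk, smul_zero, smul_eq_mul,
    div_mul_cancel₀ _ hpos.ne', Prod.mk_add_mk, add_zero, add_sub_cancel]

theorem tangentSpace_monodromyElement_inv (hW : IsNondegenerate W w h) (p : Fin (m + 1) → ℂ) :
    tangentSpace W w h (monodromyElement hW)⁻¹ 1 p = LinearMap.ker (linkDifferential W p) := by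
  ext v
  rw [LinearMap.mem_ker]
  exact (and_iff_right (monodromyElement_inv_smul_flow_smul hW v)).trans Prod.mk_eq_zero.symm

theorem finrank_tangentSpace_monodromyElement_inv (hW : IsNondegenerate W w h) (hp : p ≠ 0)
    (hWp : eval p W = 0) :
    Module.finrank ℝ (tangentSpace W w h (monodromyElement hW)⁻¹ 1 p) = 2 * m - 1 := by
  have hrank := (linkDifferential W p).finrank_range_add_finrank_ker
  rw [LinearMap.range_eq_top.mpr (linkDifferential_surjective hW hp hWp), finrank_top,
    Module.finrank_prod, Complex.finrank_real_complex, Module.finrank_self,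
    Module.finrank_pi_fintype] at hrank
  simp only [Complex.finrank_real_complex, Finset.sum_const, Finset.card_univ, Fintype.card_fin,
    smul_eq_mul] at hrank
  rw [tangentSpace_monodromyElement_inv]
  omega

theorem orbitsDim_monodromyElement_inv (hm : 1 ≤ m) (hW : IsNondegenerate W w h) (hδ : 0 < δ) :
    orbitsDim W w h δ (monodromyElement hW)⁻¹ 1 = 2 * m - 1 := by
  have hdim : {d | ∃ p ∈ twistedOrbits W w h δ (monodromyElement hW)⁻¹ 1,
      d = Module.finrank ℝ (tangentSpace W w h (monodromyElement hW)⁻¹ 1 p)} = {2 * m - 1} := by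
    rw [twistedOrbits_monodromyElement_inv]
    have hfinrank := fun p (hp : p ∈ link W δ) =>
      finrank_tangentSpace_monodromyElement_inv hW (ne_zero_of_mem_link hδ.ne' hp) hp.1
    refine Set.eq_singleton_iff_unique_mem.mpr ⟨?_, ?_⟩
    · obtain ⟨p, hp⟩ := hW.link_nonempty hm hδ
      exact ⟨p, hp, (hfinrank p hp).symm⟩
    · rintro d ⟨p, hp, rfl⟩
      exact hfinrank p hp
  rw [orbitsDim, hdim, csSup_singleton]

theorem degreeShift_monodromyElement_inv (hm : 1 ≤ m) (hW : IsNondegenerate W w h) (hδ : 0 < δ) :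
    degreeShift W w h δ (monodromyElement hW)⁻¹ 1 =
      -componentIndex W w h δ (monodromyElement hW)⁻¹ 1 := by
  rw [degreeShift, orbitsDim_monodromyElement_inv hm hW hδ, Nat.cast_sub (by omega)]
  push_cast
  ring

theorem deg_monodromyOrbit (hm : 1 ≤ m) (hW : IsNondegenerate W w h) (hδ : 0 < δ) :
    (monodromyOrbit hW δ).deg = -(monodromyOrbit hW δ).muRS := by
  change ((0 : ℕ) : ℝ) + degreeShift W w h δ (monodromyElement hW)⁻¹ 1 = _
  rw [degreeShift_monodromyElement_inv hm hW hδ, Nat.cast_zero, zero_add]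
  rfl

end PrincipalOrbits

end MonodromyOrbit

end

theorem mainTheorem7 {m : ℕ} (hm : 1 ≤ m) (W : MvPolynomial (Fin (m + 1)) ℂ)
    (w : Fin (m + 1) → ℕ) (h : ℕ) (hW : MonodromyOrbit.IsNondegenerate W w h)
    (δ : ℝ) (hδ : 0 < δ) :
    (MonodromyOrbit.monodromyOrbit hW δ).indexValues
        = {(MonodromyOrbit.monodromyOrbit hW δ).muRS} ∧
    (MonodromyOrbit.monodromyOrbit hW δ).deg = -(MonodromyOrbit.monodromyOrbit hW δ).muRS ∧
    -(MonodromyOrbit.monodromyOrbit hW δ).muRS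
        = -(2 * ((∑ i, (w i : ℝ)) - (h : ℝ)) / (h : ℝ)) ∧
    (0 ≤ (∑ i, (w i : ℤ)) - (h : ℤ) ↔ 0 ≤ (MonodromyOrbit.monodromyOrbit hW δ).muRS) := by
  have hvalues := MonodromyOrbit.indexValues_monodromyElement_inv hm hW hδ
  have hmuRS : (MonodromyOrbit.monodromyOrbit hW δ).muRS = 2 * ((∑ i, (w i : ℝ)) - h) / h :=
    MonodromyOrbit.componentIndex_eq_of_indexValues_eq_singleton hvalues
  refine ⟨?_, MonodromyOrbit.deg_monodromyOrbit hm hW hδ, by rw [hmuRS], ?_⟩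
  · rw [hmuRS]
    exact hvalues
  · have hcast : (∑ i, (w i : ℝ)) - h = (((∑ i, (w i : ℤ)) - h : ℤ) : ℝ) := by push_cast; rfl
    rw [hmuRS, le_div_iff₀ (Nat.cast_pos.mpr hW.h_pos), zero_mul,
      mul_nonneg_iff_of_pos_left two_pos, hcast, Int.cast_nonneg_iff]
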